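/- Let $d\ge 1$, let $\mathcal X\subset\mathbb R^d$ and $\mathcal Y\subset\mathbb R$ be measurable, and let $\rho$ be a probability distribution on $\mathcal X\times\mathcal Y$ with marginal $\rho_X$ on $\mathcal X$. Let $\mathcal L(g)=\mathbb E_{(X,Y)\sim\rho}\big[\tfrac12(g(X)-Y)^2\big]$, and let $g_\rho$ be a Bayes rule, i.e. a minimizer of $\mathcal L$ over all measurable functions $g:\mathcal X\to\mathbb R$. Assume: (A1) $\sigma:\mathbb R\to\mathbb R$ is twice differentiable and there is $C>0$ with $|\sigma''(u)|\le C$, $|\sigma'(u)|\le 2$ and $|\sigma(u)|\le 1+|u|$ for all $u\in\mathbb R$. (A2) $\mathrm{supp}(\rho_X)\subset\{x\in\mathbb R^d : \|x\|_2\le 1\}$, $\mathcal Y\subset[-1,1]$, and $\gamma\in[0,1]$. Let $\mu_0$ be the uniform distribution on the unit sphere $\mathbb S^{d-1}\subset\mathbb R^d$. For $x,x'\in\mathcal X$ let $$k_\infty(x,x')=\mathbb E_{b\sim\mu_0}[\sigma(b^\top x)\sigma(b^\top x')]+(x^\top x'+\gamma^2)\,\mathbb E_{b\sim\mu_0}[\sigma'(b^\top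 x)\sigma'(b^\top x')],$$ and for even $M$ let $$k_M(x,x')=\frac1M\sum_{r=1}^M\sigma(b_r^\top x)\sigma(b_r^\top x')+\frac{x^\top x'+\gamma^2}{M}\sum_{r=1}^M\sigma'(b_r^\top x)\sigma'(b_r^\top x'),$$ where $b_1,\dots,b_{M/2}$ are drawn independently from $\mu_0$ and $b_{r+M/2}=b_r$ for $1\le r\le M/2$. For $M$ an even positive integer or $M=\infty$, let $\mathcal H_M$ be the reproducing kernel Hilbert space of functions on $\mathcal X$ with kernel $k_M$, and let $\Sigma_M$ be the integral operator $f\mapsto\int f(x)\,k_M(x,\cdot)\,\mathrm d\rho_X(x)$ on $L_2(\rho_X)$. Fix $\lambda>0$, and let $g_{M,\lambda}$ be the unique minimizer of $\mathcal L(g)+\frac\lambda2\|g\|_{\mathcal H_M}^2$ over $g\in\mathcal H_M$. Suppose $g_\rho\in\mathcal H_\infty$. Then for every $\delta\in(0,1)$ there is $M_0\in\mathbb Z_{+}$ such that for every even $M\ge M_0$, with probability at least $1-\delta$ over $b_1,\dots,b_{M/2}$, the following hold simultaneously: $$\|(\Sigma_M+\lambda I)^{-1}g_{M,\lambda}\|_{L_2(\rho_X)}^2\le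 2\lambda^{-1}\|g_\rho\|_{\mathcal H_\infty}^2,\qquad \|(\Sigma_M+\lambda I)^{-1/2}g_{M,\lambda}\|_{L_2(\rho_X)}^2\le 2\|g_\rho\|_{\mathcal H_\infty}^2,$$ and, if $\lambda\le\|\Sigma_\infty\|_{\mathrm{op}}$ (operator norm on $L_2(\rho_X)$), $$\mathrm{tr}\big(\Sigma_M(\Sigma_M+\lambda I)^{-1}\big)\le 3\,\mathrm{tr}\big(\Sigma_\infty(\Sigma_\infty+\lambda I)^{-1}\big),$$ where both traces are finite. -/

import Mathlib

open MeasureTheory Metric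
open scoped ENNReal InnerProductSpace

/-- Assumption (A1) on the activation function: `σ` is twice differentiable, `σ''` is bounded,
`|σ'| ≤ 2` and `|σ u| ≤ 1 + |u|`. -/
structure ActivationAssumption (σ : ℝ → ℝ) : Prop where
  differentiable : Differentiable ℝ σ
  differentiable_deriv : Differentiable ℝ (deriv σ)
  bounded_deriv_deriv : ∃ C : ℝ, 0 < C ∧ ∀ u, |deriv (deriv σ) u| ≤ C
  abs_deriv_le : ∀ u, |deriv σ u| ≤ 2
  abs_le : ∀ u, |σ u| ≤ 1 + |u|

/-- The uniform distribution on the unit sphere of `ℝ^d`: normalized surface measure. -/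
noncomputable def uniformSphere (d : ℕ) : Measure (sphere (0 : EuclideanSpace ℝ (Fin d)) 1) :=
  ((volume : Measure (EuclideanSpace ℝ (Fin d))).toSphere Set.univ)⁻¹ •
    (volume : Measure (EuclideanSpace ℝ (Fin d))).toSphere

/-- The neural tangent kernel `k_∞` (output weights initialized at `± R` with `R = 1`). -/
noncomputable def ntk {d : ℕ} (σ : ℝ → ℝ) (γ : ℝ) (x x' : EuclideanSpace ℝ (Fin d)) : ℝ :=
  (∫ b, σ ⟪(b : EuclideanSpace ℝ (Fin d)), x⟫_ℝ * σ ⟪(b : EuclideanSpace ℝ (Fin d)), x'⟫_ℝ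
      ∂(uniformSphere d)) +
    (⟪x, x'⟫_ℝ + γ ^ 2) *
      ∫ b, deriv σ ⟪(b : EuclideanSpace ℝ (Fin d)), x⟫_ℝ *
        deriv σ ⟪(b : EuclideanSpace ℝ (Fin d)), x'⟫_ℝ ∂(uniformSphere d)

/-- The random feature kernel `k_M` with hidden weights `b_1, …, b_M`. -/
noncomputable def rfKernel {d M : ℕ} (σ : ℝ → ℝ) (γ : ℝ)
    (b : Fin M → sphere (0 : EuclideanSpace ℝ (Fin d)) 1) (x x' : EuclideanSpace ℝ (Fin d)) : ℝ :=
  (1 / (M : ℝ)) * ∑ r, σ ⟪(b r : EuclideanSpace ℝ (Fin d)), x⟫_ℝ *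
      σ ⟪(b r : EuclideanSpace ℝ (Fin d)), x'⟫_ℝ +
    ((⟪x, x'⟫_ℝ + γ ^ 2) / (M : ℝ)) *
      ∑ r, deriv σ ⟪(b r : EuclideanSpace ℝ (Fin d)), x⟫_ℝ *
        deriv σ ⟪(b r : EuclideanSpace ℝ (Fin d)), x'⟫_ℝ

/-- Symmetric initialization of width `M = 2m`: the first half `b_1, …, b_m` is repeated,
so `b_r = b_{r + m}`. -/
def symInit {d m : ℕ} (b : Fin m → sphere (0 : EuclideanSpace ℝ (Fin d)) 1) :
    Fin (m + m) → sphere (0 : EuclideanSpace ℝ (Fin d)) 1 :=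
  Fin.append b b

/-- The kernel `k` restricted to `𝒳`, as a matrix of (scalar) operators on `ℝ`; this is the format
in which `RKHS.kernel` and `RKHS.OfKernel` treat kernels. -/
noncomputable def kernelMatrix {d : ℕ} (𝒳 : Set (EuclideanSpace ℝ (Fin d)))
    (k : EuclideanSpace ℝ (Fin d) → EuclideanSpace ℝ (Fin d) → ℝ) : Matrix 𝒳 𝒳 (ℝ →L[ℝ] ℝ) :=
  Matrix.of fun x y => k x y • ContinuousLinearMap.id ℝ ℝ

theorem kernelMatrix_posSemidef {d : ℕ} (𝒳 : Set (EuclideanSpace ℝ (Fin d)))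
    (k : EuclideanSpace ℝ (Fin d) → EuclideanSpace ℝ (Fin d) → ℝ) (hs : ∀ x y, k x y = k y x)
    (hp : ∀ (s : Finset 𝒳) (w : 𝒳 → ℝ), 0 ≤ ∑ x ∈ s, ∑ y ∈ s, w x * w y * k x y) :
    (kernelMatrix 𝒳 k).PosSemidef := by
  have h := (RKHS.posSemidef_tfae (K := kernelMatrix 𝒳 k)).out 0 2
  rw [h]
  refine ⟨?_, fun w => ?_⟩
  · ext x y
    simp [kernelMatrix, hs (x : EuclideanSpace ℝ (Fin d)) y, Matrix.conjTranspose_apply,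
      ContinuousLinearMap.star_eq_adjoint, ContinuousLinearMap.adjoint_id]
  · refine (hp w.support w).trans (le_of_eq ?_)
    simp only [Finsupp.sum, kernelMatrix, Matrix.of_apply, RCLike.re_to_real]
    refine Finset.sum_congr rfl fun x _ => Finset.sum_congr rfl fun y _ => ?_
    simp [hs (y : EuclideanSpace ℝ (Fin d)) x]
    ring

theorem rfKernel_posSemidef {d M : ℕ} (𝒳 : Set (EuclideanSpace ℝ (Fin d))) (σ : ℝ → ℝ) (γ : ℝ)
    (b : Fin M → sphere (0 : EuclideanSpace ℝ (Fin d)) 1) :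
    (kernelMatrix 𝒳 (rfKernel σ γ b)).PosSemidef := by
  refine kernelMatrix_posSemidef 𝒳 _ (fun x y => ?_) (fun s w => ?_)
  · simp only [rfKernel, real_inner_comm x y]
    congr 2 <;> exact Finset.sum_congr rfl fun r _ => mul_comm _ _
  · set p : Fin M → 𝒳 → ℝ := fun r x => σ ⟪(b r : EuclideanSpace ℝ (Fin d)), x⟫_ℝ with hpd
    set q : Fin M → 𝒳 → ℝ := fun r x => deriv σ ⟪(b r : EuclideanSpace ℝ (Fin d)), x⟫_ℝ with hqd
    have key : ∑ x ∈ s, ∑ y ∈ s, w x * w y * rfKernel σ γ b x y =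
        (1 / (M : ℝ)) * ∑ r, ((∑ x ∈ s, w x * p r x) ^ 2 + γ ^ 2 * (∑ x ∈ s, w x * q r x) ^ 2 +
          ⟪∑ x ∈ s, (w x * q r x) • (x : EuclideanSpace ℝ (Fin d)),
            ∑ x ∈ s, (w x * q r x) • (x : EuclideanSpace ℝ (Fin d))⟫_ℝ) := by
      have e : ∀ x y : 𝒳, w x * w y * rfKernel σ γ b x y = ∑ r, (1 / (M : ℝ)) *
          ((w x * p r x) * (w y * p r y) + γ ^ 2 * ((w x * q r x) * (w y * q r y)) +
            (w x * q r x) * ((w y * q r y) *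
              ⟪(x : EuclideanSpace ℝ (Fin d)), (y : EuclideanSpace ℝ (Fin d))⟫_ℝ)) := by
        intro x y
        simp only [rfKernel, mul_add, Finset.mul_sum, ← Finset.sum_add_distrib]
        refine Finset.sum_congr rfl fun r _ => ?_
        simp only [hpd, hqd]
        ring
      simp only [e]
      rw [Finset.sum_congr rfl fun x _ => Finset.sum_comm, Finset.sum_comm, Finset.mul_sum]
      refine Finset.sum_congr rfl fun r _ => ?_
      simp only [← Finset.mul_sum, Finset.sum_add_distrib, sq, Finset.sum_mul_sum, sum_inner,
        inner_sum, real_inner_smul_left, real_inner_smul_right]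
      simp only [real_inner_comm]
    rw [key]
    refine mul_nonneg (by positivity) (Finset.sum_nonneg fun r _ => ?_)
    have := real_inner_self_nonneg
      (x := ∑ x ∈ s, (w x * q r x) • (x : EuclideanSpace ℝ (Fin d)))
    positivity

instance rfKernel_fact {d M : ℕ} (𝒳 : Set (EuclideanSpace ℝ (Fin d))) (σ : ℝ → ℝ) (γ : ℝ)
    (b : Fin M → sphere (0 : EuclideanSpace ℝ (Fin d)) 1) :
    Fact (kernelMatrix 𝒳 (rfKernel σ γ b)).PosSemidef :=
  ⟨rfKernel_posSemidef 𝒳 σ γ b⟩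

/-- The reproducing kernel Hilbert space `H_M` of functions on `𝒳` with kernel `k_M`. -/
abbrev RFSpace {d M : ℕ} (𝒳 : Set (EuclideanSpace ℝ (Fin d))) (σ : ℝ → ℝ) (γ : ℝ)
    (b : Fin M → sphere (0 : EuclideanSpace ℝ (Fin d)) 1) : Type :=
  RKHS.OfKernel (kernelMatrix 𝒳 (rfKernel σ γ b))

/-- The expected risk `E[(g(X) - Y)^2 / 2]` of a hypothesis, with values in `[0, ∞]`. -/
noncomputable def expectedRisk {α : Type*} [MeasurableSpace α] {𝒴 : Set ℝ}
    (ρ : Measure (α × 𝒴)) (g : α → ℝ) : ℝ≥0∞ :=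
  ∫⁻ z, ENNReal.ofReal (1 / 2 * (g z.1 - (z.2 : ℝ)) ^ 2) ∂ρ

/-- `g` is a Bayes rule: a global minimizer of the expected risk over all measurable functions. -/
def IsBayesRule {α : Type*} [MeasurableSpace α] {𝒴 : Set ℝ}
    (ρ : Measure (α × 𝒴)) (g : α → ℝ) : Prop :=
  Measurable g ∧ ∀ h : α → ℝ, Measurable h → expectedRisk ρ g ≤ expectedRisk ρ h

/-- `g` minimizes the regularized expected risk `g ↦ L(g) + (lam / 2) ‖g‖²` over the reproducing
kernel Hilbert space `H`. -/
def IsRegularizedMinimizer {α : Type*} [MeasurableSpace α] {𝒴 : Set ℝ} {H : Type*}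
    [NormedAddCommGroup H] [InnerProductSpace ℝ H] [RKHS ℝ H α ℝ]
    (ρ : Measure (α × 𝒴)) (lam : ℝ) (g : H) : Prop :=
  ∀ h : H, expectedRisk ρ g + ENNReal.ofReal (lam / 2 * ‖g‖ ^ 2) ≤
    expectedRisk ρ h + ENNReal.ofReal (lam / 2 * ‖h‖ ^ 2)

/-- `T` is the integral operator `f ↦ ∫ f(X) k(X, ·) dμ(X)` on `L²(μ)`. -/
def IsIntegralOperator {α : Type*} [MeasurableSpace α] (μ : Measure α) (k : α → α → ℝ)
    (T : Lp ℝ 2 μ →L[ℝ] Lp ℝ 2 μ) : Prop :=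
  ∀ f : Lp ℝ 2 μ, ∀ᵐ x ∂μ,
    Integrable (fun y => f y * k y x) μ ∧ T f x = ∫ y, f y * k y x ∂μ

/-- `S = A^{-1/2}`: the operator `A` is invertible, and `S` is the positive square root of its
inverse. -/
def IsInvSqrt {H : Type*} [NormedAddCommGroup H] [InnerProductSpace ℝ H]
    (A S : H →L[ℝ] H) : Prop :=
  IsUnit A ∧ S.IsPositive ∧ S * S = Ring.inverse A

/-- The operator `T` has trace `t`: the sum `∑ ⟪e_i, T e_i⟫` converges (unconditionally) to `t` for
every Hilbert basis `(e_i)`. -/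
def HasTrace.{u} {H : Type u} [NormedAddCommGroup H] [InnerProductSpace ℝ H]
    (T : H →L[ℝ] H) (t : ℝ) : Prop :=
  ∀ (ι : Type u) (e : HilbertBasis ι ℝ H), HasSum (fun i => ⟪e i, T (e i)⟫_ℝ) t

/-!
Write `E = L²(ρ_X)`. The inclusion `V` of a reproducing kernel Hilbert space with bounded kernel
into `E` is bounded, and the integral operator of the kernel is `Σ = V Vᵀ`. Completing the square
shows that the regularized minimizer is `Vᵀ (Σ_M + lam)⁻¹ gρ`, so in `E` it is `Σ_M R_M gρ` with
`R_M = (Σ_M + lam)⁻¹`. Both norm bounds then reduce to `⟪gρ, R_M gρ⟫ ≤ ‖gρ‖²`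
(`IsInvSqrt.norm_sq_ridge_le`), and this holds as soon as `Σ_∞ ≤ Σ_M + lam`
(`inner_resolventAt_le_norm_sq`). The operator norm of `Σ_M - Σ_∞` is at most the
`L²(ρ_X ⊗ ρ_X)` norm of `k_M - k_∞`; the kernel `k_M` is an average of independent bounded kernels
with mean `k_∞`, so the expected square of that norm is `O(1 / M)`, and Markov's inequality applies
(`measure_pi_kernel_sub_sq_ge_le`).

For the traces, `t ↦ t / (t + lam)` is operator concave, so `Σ_M R_M` lies below its tangent
`Σ_∞ R_∞ + lam R_∞ (Σ_M - Σ_∞) R_∞` (`inner_apply_resolventAt_le_tangent`). Only the scalar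
`tr (R_∞ Σ_M R_∞)` has to be controlled: it is an average of independent bounded random variables
with mean `tr (R_∞ Σ_∞ R_∞)` (`exists_trace_neuron`), so by Chebyshev's inequality it exceeds its
mean by at most `1 / lam` with high probability. The trace for `Σ_M` is then at most `1` more than
the trace for `Σ_∞`, which itself is at least `1 / 2` when `lam ≤ ‖Σ_∞‖`
(`half_le_trace_comp_resolventAt`).

The square root of the resolvent is obtained from the contraction principle
(`exists_isPositive_sqrt_of_norm_one_sub_le`).
-/

/-! ### Resolvents of positive operators -/

section Resolvent

variable {E : Type*} [NormedAddCommGroup E] [InnerProductSpace ℝ E] [CompleteSpace E]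
  {T : E →L[ℝ] E} {lam : ℝ}

theorem ContinuousLinearMap.IsPositive.isUnit_add_smul_one (hT : T.IsPositive) (hlam : 0 < lam) :
    IsUnit (T + lam • (1 : E →L[ℝ] E)) := by
  refine isUnit_of_forall_le_norm_inner_map _ (c := ⟨lam, hlam.le⟩) hlam fun x => ?_
  have h := hT.inner_nonneg_left x
  have e : ⟪(T + lam • (1 : E →L[ℝ] E)) x, x⟫_ℝ = ⟪T x, x⟫_ℝ + lam * ‖x‖ ^ 2 := by
    simp [inner_add_left, real_inner_smul_left]
  rw [e, Real.norm_of_nonneg (by positivity)]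
  change ‖x‖ ^ 2 * lam ≤ _
  linarith

/-- The resolvent `(T + lam)⁻¹`; `Ring.inverse` makes it `0` where `T + lam` is not invertible. -/
noncomputable abbrev resolventAt (T : E →L[ℝ] E) (lam : ℝ) : E →L[ℝ] E :=
  Ring.inverse (T + lam • (1 : E →L[ℝ] E))

theorem apply_resolventAt_add (hT : T.IsPositive) (hlam : 0 < lam) (x : E) :
    T (resolventAt T lam x) + lam • resolventAt T lam x = x := by
  simpa using congrArg (fun S : E →L[ℝ] E => S x)
    (Ring.mul_inverse_cancel _ (hT.isUnit_add_smul_one hlam))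

theorem resolventAt_apply_add (hT : T.IsPositive) (hlam : 0 < lam) (x : E) :
    resolventAt T lam (T x + lam • x) = x := by
  simpa using congrArg (fun S : E →L[ℝ] E => S x)
    (Ring.inverse_mul_cancel _ (hT.isUnit_add_smul_one hlam))

theorem inner_resolventAt_comm (hT : T.IsPositive) (hlam : 0 < lam) (x y : E) :
    ⟪resolventAt T lam x, y⟫_ℝ = ⟪x, resolventAt T lam y⟫_ℝ := by
  conv_lhs => rw [← apply_resolventAt_add hT hlam y]
  conv_rhs => rw [← apply_resolventAt_add hT hlam x]
  simp only [inner_add_left, inner_add_right, real_inner_smul_left, real_inner_smul_right,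
    hT.inner_left_eq_inner_right]

theorem norm_apply_resolventAt_sq_add_le (hT : T.IsPositive) (hlam : 0 < lam) (x : E) :
    ‖T (resolventAt T lam x)‖ ^ 2 + lam ^ 2 * ‖resolventAt T lam x‖ ^ 2 ≤ ‖x‖ ^ 2 := by
  set y := resolventAt T lam x with hy
  have h := hT.inner_nonneg_left y
  have e := apply_resolventAt_add hT hlam x
  rw [← hy] at e
  rw [← e, norm_add_sq_real, real_inner_smul_right, norm_smul, mul_pow, Real.norm_eq_abs, sq_abs]
  nlinarith [mul_nonneg hlam.le h]

theorem norm_apply_resolventAt_le (hT : T.IsPositive) (hlam : 0 < lam) (x : E) :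
    ‖T (resolventAt T lam x)‖ ≤ ‖x‖ := by
  refine le_of_sq_le_sq ?_ (norm_nonneg x)
  nlinarith [norm_apply_resolventAt_sq_add_le hT hlam x,
    sq_nonneg (lam * ‖resolventAt T lam x‖)]

theorem norm_resolventAt_apply_le (hT : T.IsPositive) (hlam : 0 < lam) (x : E) :
    lam * ‖resolventAt T lam x‖ ≤ ‖x‖ := by
  refine le_of_sq_le_sq ?_ (norm_nonneg x)
  nlinarith [norm_apply_resolventAt_sq_add_le hT hlam x,
    sq_nonneg ‖T (resolventAt T lam x)‖]

theorem inner_resolventAt_nonneg (hT : T.IsPositive) (hlam : 0 < lam) (x : E) :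
    0 ≤ ⟪x, resolventAt T lam x⟫_ℝ := by
  nth_rw 1 [← apply_resolventAt_add hT hlam x]
  rw [inner_add_left, real_inner_smul_left, real_inner_self_eq_norm_sq]
  have := hT.inner_nonneg_left (resolventAt T lam x)
  positivity

theorem inner_resolventAt_le (hT : T.IsPositive) (hlam : 0 < lam) (x : E) :
    ⟪x, resolventAt T lam x⟫_ℝ ≤ lam⁻¹ * ‖x‖ ^ 2 := by
  have h1 := real_inner_le_norm x (resolventAt T lam x)
  have h2 := norm_resolventAt_apply_le hT hlam x
  rw [inv_mul_eq_div, le_div_iff₀ hlam]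
  nlinarith [mul_le_mul_of_nonneg_left h2 (norm_nonneg x),
    mul_le_mul_of_nonneg_right h1 hlam.le]

/-- Square root by the fixed-point equation `Y = (B + Y ^ 2) / 2` with `B = 1 - S`: its solution
satisfies `(1 - Y) ^ 2 = 1 - B = S`, and the right-hand side is a contraction of the ball of radius
`q`. -/
theorem exists_isPositive_sqrt_of_norm_one_sub_le {S : E →L[ℝ] E} (hS : IsSelfAdjoint S) {q : ℝ}
    (hq0 : 0 ≤ q) (hq : q < 1) (hSq : ‖1 - S‖ ≤ q) :
    ∃ Q : E →L[ℝ] E, Q.IsPositive ∧ Q * Q = S := by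
  set B : E →L[ℝ] E := 1 - S with hB
  have hBs : IsSelfAdjoint B := (IsSelfAdjoint.one _).sub hS
  set K : Set (E →L[ℝ] E) := {Y | ‖Y‖ ≤ q} ∩ {Y | IsSelfAdjoint Y} with hK
  have hKc : IsClosed K :=
    (isClosed_le continuous_norm continuous_const).inter
      (isClosed_eq continuous_star continuous_id)
  let F : (E →L[ℝ] E) → (E →L[ℝ] E) := fun Y => (2 : ℝ)⁻¹ • (B + Y * Y)
  have hF : Set.MapsTo F K K := by
    rintro Y ⟨hY, hYs⟩
    have hYs' : IsSelfAdjoint Y := hYs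
    refine ⟨?_, ?_⟩
    · have h1 : ‖B + Y * Y‖ ≤ q + q * q :=
        (norm_add_le _ _).trans (add_le_add hSq ((norm_mul_le _ _).trans
          (mul_le_mul hY hY (norm_nonneg _) hq0)))
      change ‖(2 : ℝ)⁻¹ • (B + Y * Y)‖ ≤ q
      rw [norm_smul, Real.norm_of_nonneg (by norm_num)]
      nlinarith
    · refine IsSelfAdjoint.smul (IsSelfAdjoint.all _) (hBs.add ?_)
      rw [IsSelfAdjoint, star_mul, hYs'.star_eq]
  have hc : ContractingWith ⟨q, hq0⟩ (hF.restrict F K K) := by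
    refine ⟨hq, LipschitzWith.of_dist_le_mul fun Y Z => ?_⟩
    rcases Y with ⟨Y, hY, -⟩
    rcases Z with ⟨Z, hZ, -⟩
    change dist (F Y) (F Z) ≤ q * dist Y Z
    rw [dist_eq_norm, dist_eq_norm]
    have e : F Y - F Z = (2 : ℝ)⁻¹ • (Y * (Y - Z) + (Y - Z) * Z) := by
      simp only [F, ← smul_sub]
      congr 1
      noncomm_ring
    have h1 : ‖Y * (Y - Z) + (Y - Z) * Z‖ ≤ q * ‖Y - Z‖ + ‖Y - Z‖ * q :=
      (norm_add_le _ _).trans (add_le_add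
        ((norm_mul_le _ _).trans (mul_le_mul_of_nonneg_right hY (norm_nonneg _)))
        ((norm_mul_le _ _).trans (mul_le_mul_of_nonneg_left hZ (norm_nonneg _))))
    rw [e, norm_smul, Real.norm_of_nonneg (by norm_num)]
    linarith
  obtain ⟨Y, ⟨hY, hYs⟩, hfix, -, -⟩ := hc.exists_fixedPoint' hKc.isComplete hF
    (x := 0) ⟨by simpa using hq0, IsSelfAdjoint.zero _⟩ (edist_ne_top _ _)
  have hYs' : IsSelfAdjoint Y := hYs
  have hY' : ‖Y‖ ≤ q := hY
  refine ⟨1 - Y, ?_, ?_⟩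
  · rw [ContinuousLinearMap.isPositive_def']
    refine ⟨(IsSelfAdjoint.one _).sub hYs', fun x => ?_⟩
    have h1 : ⟪Y x, x⟫_ℝ ≤ q * ‖x‖ * ‖x‖ :=
      (real_inner_le_norm _ _).trans (mul_le_mul_of_nonneg_right
        ((Y.le_opNorm x).trans (mul_le_mul_of_nonneg_right hY' (norm_nonneg _))) (norm_nonneg _))
    simp only [ContinuousLinearMap.reApplyInnerSelf_apply, RCLike.re_to_real,
      sub_apply, one_apply_eq_self, inner_sub_left,
      real_inner_self_eq_norm_sq]
    nlinarith [norm_nonneg x]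
  · have h2 : (2 : ℝ)⁻¹ • (B + Y * Y) = Y := hfix
    have h3 : B + Y * Y = Y + Y := by
      rw [← two_smul ℝ Y, ← h2, smul_smul, mul_inv_cancel₀ two_ne_zero, one_smul, h2]
    have : (1 - Y) * (1 - Y) = 1 - (Y + Y) + Y * Y := by noncomm_ring
    rw [this, ← h3, hB]
    abel

/-- The scaled resolvent `lam (T + lam)⁻¹` is within distance `q < 1` of the identity. -/
theorem exists_isInvSqrt (hT : T.IsPositive) (hlam : 0 < lam) :
    ∃ A : E →L[ℝ] E, IsInvSqrt (T + lam • (1 : E →L[ℝ] E)) A := by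
  set R := resolventAt T lam with hR
  have hs : IsSelfAdjoint (lam • R) := by
    refine IsSelfAdjoint.smul (IsSelfAdjoint.all _) ?_
    rw [ContinuousLinearMap.isSelfAdjoint_iff_isSymmetric]
    exact fun x y => inner_resolventAt_comm hT hlam x y
  set a := ‖T‖ with ha
  set q := a / √(a ^ 2 + lam ^ 2) with hq
  have ha0 : 0 ≤ a := norm_nonneg T
  have hpos : 0 < √(a ^ 2 + lam ^ 2) := Real.sqrt_pos.2 (by positivity)
  have hq0 : 0 ≤ q := by positivity
  have hq1 : q < 1 := by
    rw [hq, div_lt_one hpos]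
    exact Real.lt_sqrt_of_sq_lt (by nlinarith [sq_pos_of_pos hlam])
  have hn : ‖1 - lam • R‖ ≤ q := by
    refine ContinuousLinearMap.opNorm_le_bound _ hq0 fun x => ?_
    have e : (1 - lam • R) x = T (R x) := by
      have := apply_resolventAt_add hT hlam x
      simp only [sub_apply, one_apply_eq_self, smul_apply]
      exact sub_eq_iff_eq_add.2 this.symm
    rw [e, hq, div_mul_eq_mul_div, le_div_iff₀ hpos]
    refine le_of_sq_le_sq ?_ (by positivity)
    rw [mul_pow, mul_pow, Real.sq_sqrt (by positivity)]
    have h1 := norm_apply_resolventAt_sq_add_le hT hlam x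
    have h2 : ‖T (R x)‖ ^ 2 ≤ a ^ 2 * ‖R x‖ ^ 2 := by
      rw [← mul_pow]
      exact pow_le_pow_left₀ (norm_nonneg _) (T.le_opNorm _) 2
    nlinarith [mul_le_mul_of_nonneg_left h1 (sq_nonneg a),
      mul_le_mul_of_nonneg_left h2 (sq_nonneg lam)]
  obtain ⟨Q, hQ, hQQ⟩ := exists_isPositive_sqrt_of_norm_one_sub_le hs hq0 hq1 hn
  refine ⟨(√lam)⁻¹ • Q, hT.isUnit_add_smul_one hlam, hQ.smul_of_nonneg (by positivity), ?_⟩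
  rw [smul_mul_smul_comm, hQQ, ← mul_inv, Real.mul_self_sqrt hlam.le, smul_smul,
    inv_mul_cancel₀ hlam.ne', one_smul]

end Resolvent

/-! ### Inverse square roots and traces -/

section Trace

variable {E : Type*} [NormedAddCommGroup E] [InnerProductSpace ℝ E]
  {H : Type*} [NormedAddCommGroup H] [InnerProductSpace ℝ H]
  {T A : E →L[ℝ] E} {lam : ℝ}

theorem IsInvSqrt.apply_apply (hA : IsInvSqrt (T + lam • (1 : E →L[ℝ] E)) A) (x : E) :
    A (A x) = resolventAt T lam x :=
  congrArg (fun S : E →L[ℝ] E => S x) hA.2.2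

theorem IsInvSqrt.norm_apply_sq (hA : IsInvSqrt (T + lam • (1 : E →L[ℝ] E)) A) (x : E) :
    ‖A x‖ ^ 2 = ⟪x, resolventAt T lam x⟫_ℝ := by
  rw [← real_inner_self_eq_norm_sq, hA.2.1.inner_left_eq_inner_right, hA.apply_apply]

theorem HilbertBasis.hasSum_inner_sq {ι : Type*} (e : HilbertBasis ι ℝ E) (x : E) :
    HasSum (fun i => ⟪e i, x⟫_ℝ ^ 2) (‖x‖ ^ 2) := by
  have h := e.hasSum_inner_mul_inner x x
  rw [real_inner_self_eq_norm_sq] at h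
  refine h.congr_fun fun i => ?_
  rw [real_inner_comm, sq]

theorem Orthonormal.countable [SecondCountableTopology E] {ι : Type*} {e : ι → E}
    (he : Orthonormal ℝ e) : Countable ι := by
  rw [← Set.countable_univ_iff]
  refine Set.PairwiseDisjoint.countable_of_isOpen (s := fun i => ball (e i) (1 / 2)) ?_
    (fun i _ => isOpen_ball) (fun i _ => ⟨e i, by simp⟩)
  intro i _ j _ hij
  refine ball_disjoint_ball ?_
  have h : ‖e i - e j‖ ^ 2 = 2 := by
    rw [norm_sub_sq_real, he.1 i, he.1 j, he.2 hij]
    norm_num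
  rw [dist_eq_norm]
  nlinarith [norm_nonneg (e i - e j)]

variable [CompleteSpace E]

theorem IsInvSqrt.norm_apply_sq_le (hA : IsInvSqrt (T + lam • (1 : E →L[ℝ] E)) A)
    (hT : T.IsPositive) (hlam : 0 < lam) (x : E) : ‖A x‖ ^ 2 ≤ lam⁻¹ * ‖x‖ ^ 2 :=
  (hA.norm_apply_sq x).trans_le (inner_resolventAt_le hT hlam x)

theorem IsInvSqrt.apply_comm (hA : IsInvSqrt (T + lam • (1 : E →L[ℝ] E)) A)
    (hT : T.IsPositive) (hlam : 0 < lam) (x : E) : A (T x) = T (A x) := by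
  have hc : ∀ v, resolventAt T lam (A v) = A (resolventAt T lam v) := fun v => by
    rw [← hA.apply_apply, ← hA.apply_apply]
  have hinj : Function.Injective (resolventAt T lam) := fun u v huv => by
    rw [← apply_resolventAt_add hT hlam u, ← apply_resolventAt_add hT hlam v, huv]
  have h : A (T x + lam • x) = T (A x) + lam • A x := by
    apply hinj
    rw [hc, resolventAt_apply_add hT hlam, resolventAt_apply_add hT hlam]
  rw [map_add, map_smul] at h
  exact add_right_cancel h

/-- Norms of the ridge fit `T (T + lam)⁻¹ G` weighted by powers of the resolvent. -/
theorem IsInvSqrt.norm_sq_ridge_le (hA : IsInvSqrt (T + lam • (1 : E →L[ℝ] E)) A)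
    (hT : T.IsPositive) (hlam : 0 < lam) (G : E) :
    ‖A (T (resolventAt T lam G))‖ ^ 2 ≤ ⟪G, resolventAt T lam G⟫_ℝ ∧
      ‖resolventAt T lam (T (resolventAt T lam G))‖ ^ 2 ≤
        lam⁻¹ * ⟪G, resolventAt T lam G⟫_ℝ := by
  have h1 : A (T (resolventAt T lam G)) = T (resolventAt T lam (A G)) := by
    rw [hA.apply_comm hT hlam, ← hA.apply_apply, ← hA.apply_apply]
  have h2 : ‖A (T (resolventAt T lam G))‖ ^ 2 ≤ ⟪G, resolventAt T lam G⟫_ℝ := by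
    rw [h1, ← hA.norm_apply_sq]
    exact pow_le_pow_left₀ (norm_nonneg _) (norm_apply_resolventAt_le hT hlam _) 2
  refine ⟨h2, ?_⟩
  rw [← hA.apply_apply (T _)]
  exact (hA.norm_apply_sq_le hT hlam _).trans
    (mul_le_mul_of_nonneg_left h2 (inv_nonneg.2 hlam.le))

variable [CompleteSpace H]

/-- If `V Vᵀ ≤ T + lam`, then `(T + lam)^(-1/2) V` is a contraction. -/
theorem inner_resolventAt_le_norm_sq (hT : T.IsPositive) (hlam : 0 < lam) (V : H →L[ℝ] E)
    (hV : ∀ u, ‖V.adjoint u‖ ^ 2 ≤ ⟪u, T u⟫_ℝ + lam * ‖u‖ ^ 2) (g : H) :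
    ⟪V g, resolventAt T lam (V g)⟫_ℝ ≤ ‖g‖ ^ 2 := by
  set u := resolventAt T lam (V g) with hu
  have h0 : 0 ≤ ⟪V g, u⟫_ℝ := inner_resolventAt_nonneg hT hlam _
  have h1 : ⟪V g, u⟫_ℝ ≤ ‖g‖ * ‖V.adjoint u‖ := by
    rw [← ContinuousLinearMap.adjoint_inner_right]
    exact real_inner_le_norm _ _
  have h2 : ⟪u, T u⟫_ℝ + lam * ‖u‖ ^ 2 = ⟪V g, u⟫_ℝ := by
    rw [← real_inner_self_eq_norm_sq, ← real_inner_smul_right, ← inner_add_right,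
      apply_resolventAt_add hT hlam, real_inner_comm]
  have h3 := hV u
  rw [h2] at h3
  rcases h0.eq_or_lt with h | h
  · rw [← h]; positivity
  · have h4 : ⟪V g, u⟫_ℝ ^ 2 ≤ ‖g‖ ^ 2 * ⟪V g, u⟫_ℝ := by
      calc ⟪V g, u⟫_ℝ ^ 2 ≤ (‖g‖ * ‖V.adjoint u‖) ^ 2 := pow_le_pow_left₀ h0 h1 2
        _ = ‖g‖ ^ 2 * ‖V.adjoint u‖ ^ 2 := mul_pow _ _ _
        _ ≤ _ := mul_le_mul_of_nonneg_left h3 (sq_nonneg _)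
    rw [sq ⟪V g, u⟫_ℝ] at h4
    exact le_of_mul_le_mul_right h4 h

/-- Operator concavity of `t ↦ t / (t + lam)`: its value at `T₁` lies below the tangent at `T₂`. -/
theorem inner_apply_resolventAt_le_tangent {T₁ T₂ : E →L[ℝ] E} (h₁ : T₁.IsPositive)
    (h₂ : T₂.IsPositive) (hlam : 0 < lam) (x : E) :
    ⟪x, T₁ (resolventAt T₁ lam x)⟫_ℝ ≤ ⟪x, T₂ (resolventAt T₂ lam x)⟫_ℝ +
      lam * (⟪resolventAt T₂ lam x, T₁ (resolventAt T₂ lam x)⟫_ℝ -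
        ⟪resolventAt T₂ lam x, T₂ (resolventAt T₂ lam x)⟫_ℝ) := by
  set w := resolventAt T₁ lam x with hw
  set y := resolventAt T₂ lam x with hy
  have ew : T₁ w + lam • w = x := apply_resolventAt_add h₁ hlam x
  have ey : T₂ y + lam • y = x := apply_resolventAt_add h₂ hlam x
  have a1 : ⟪x, T₁ w⟫_ℝ = ⟪x, x⟫_ℝ - lam * ⟪w, x⟫_ℝ := by
    rw [eq_sub_of_add_eq ew, inner_sub_right, real_inner_smul_right, real_inner_comm x w]
  have a2 : ⟪x, T₂ y⟫_ℝ = ⟪x, x⟫_ℝ - lam * ⟪y, x⟫_ℝ := by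
    rw [eq_sub_of_add_eq ey, inner_sub_right, real_inner_smul_right, real_inner_comm x y]
  have b1 : ⟪w, T₁ w⟫_ℝ + lam * ⟪w, w⟫_ℝ = ⟪w, x⟫_ℝ := by
    rw [← real_inner_smul_right, ← inner_add_right, ew]
  have b2 : ⟪y, T₁ w⟫_ℝ + lam * ⟪y, w⟫_ℝ = ⟪y, x⟫_ℝ := by
    rw [← real_inner_smul_right, ← inner_add_right, ew]
  have b3 : ⟪y, T₂ y⟫_ℝ + lam * ⟪y, y⟫_ℝ = ⟪y, x⟫_ℝ := by
    rw [← real_inner_smul_right, ← inner_add_right, ey]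
  have b4 : ⟪w, T₁ y⟫_ℝ = ⟪y, T₁ w⟫_ℝ := by
    rw [← h₁.inner_left_eq_inner_right, real_inner_comm]
  have c1 : 0 ≤ ⟪w - y, T₁ (w - y)⟫_ℝ := h₁.inner_nonneg_right _
  have c2 : 0 ≤ ⟪w - y, w - y⟫_ℝ := real_inner_self_nonneg
  simp only [map_sub, inner_sub_left, inner_sub_right] at c1 c2
  have c3 : ⟪w, y⟫_ℝ = ⟪y, w⟫_ℝ := real_inner_comm _ _
  have key : ⟪y, x⟫_ℝ ≤ ⟪w, x⟫_ℝ + (⟪y, T₁ y⟫_ℝ - ⟪y, T₂ y⟫_ℝ) := by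
    nlinarith [mul_nonneg hlam.le c2]
  rw [a1, a2]
  nlinarith [mul_le_mul_of_nonneg_left key hlam.le]

/-- Both sides are the sum of the squared matrix entries `⟪e i, W (f j)⟫ ^ 2`. -/
theorem hasTrace_comp_adjoint {κ : Type*} (W : H →L[ℝ] E) (f : HilbertBasis κ ℝ H)
    (hf : Summable fun j => ‖W (f j)‖ ^ 2) :
    HasTrace (W ∘L W.adjoint) (∑' j, ‖W (f j)‖ ^ 2) := by
  intro ι e
  set F : κ × ι → ℝ := fun p => ⟪e p.2, W (f p.1)⟫_ℝ ^ 2 with hF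
  have h1 : ∀ j, HasSum (fun i => F (j, i)) (‖W (f j)‖ ^ 2) := fun j =>
    e.hasSum_inner_sq (W (f j))
  have h2 : ∀ i, HasSum (fun j => F (j, i)) ⟪e i, (W ∘L W.adjoint) (e i)⟫_ℝ := fun i => by
    rw [ContinuousLinearMap.comp_apply, ← ContinuousLinearMap.adjoint_inner_left,
      real_inner_self_eq_norm_sq]
    refine (f.hasSum_inner_sq (W.adjoint (e i))).congr_fun fun j => ?_
    simp only [hF]
    rw [ContinuousLinearMap.adjoint_inner_right, real_inner_comm]
  have hs : Summable F := by
    rw [summable_prod_of_nonneg fun p => sq_nonneg _]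
    exact ⟨fun j => (h1 j).summable, hf.congr fun j => ((h1 j).tsum_eq).symm⟩
  have h3 : HasSum F (∑' j, ‖W (f j)‖ ^ 2) := by
    rw [(hs.hasSum.prod_fiberwise h1).tsum_eq]
    exact hs.hasSum
  exact ((Equiv.prodComm ι κ).hasSum_iff.2 h3).prod_fiberwise h2

theorem hasTrace_comp_resolventAt {κ : Type*} (V : H →L[ℝ] E) (hlam : 0 < lam)
    (f : HilbertBasis κ ℝ H) (hf : Summable fun j => ‖V (f j)‖ ^ 2) :
    ∃ t, HasTrace ((V ∘L V.adjoint) * resolventAt (V ∘L V.adjoint) lam) t := by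
  have hT : (V ∘L V.adjoint).IsPositive := ContinuousLinearMap.isPositive_self_comp_adjoint V
  obtain ⟨A, hA⟩ := exists_isInvSqrt hT hlam
  have e : (V ∘L V.adjoint) * resolventAt (V ∘L V.adjoint) lam =
      (A ∘L V) ∘L (A ∘L V).adjoint := by
    ext1 x
    rw [ContinuousLinearMap.adjoint_comp, hA.2.1.isSelfAdjoint.adjoint_eq]
    have h := hA.apply_comm hT hlam (A x)
    rw [hA.apply_apply] at h
    exact h.symm
  rw [e]
  refine ⟨_, hasTrace_comp_adjoint (A ∘L V) f ?_⟩
  exact Summable.of_nonneg_of_le (fun j => sq_nonneg _)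
    (fun j => hA.norm_apply_sq_le hT hlam (V (f j))) (hf.mul_left _)

theorem hasTrace_conj {κ : Type*} (V : H →L[ℝ] E) (f : HilbertBasis κ ℝ H)
    (hf : Summable fun j => ‖V (f j)‖ ^ 2) {R : E →L[ℝ] E} (hR : IsSelfAdjoint R) :
    ∃ t ≤ ‖R‖ ^ 2 * ∑' j, ‖V (f j)‖ ^ 2, HasTrace (R * (V ∘L V.adjoint) * R) t := by
  have e : R * (V ∘L V.adjoint) * R = (R ∘L V) ∘L (R ∘L V).adjoint := by
    rw [ContinuousLinearMap.adjoint_comp, hR.adjoint_eq]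
    rfl
  have hb : ∀ j, ‖(R ∘L V) (f j)‖ ^ 2 ≤ ‖R‖ ^ 2 * ‖V (f j)‖ ^ 2 := fun j => by
    rw [← mul_pow]
    exact pow_le_pow_left₀ (norm_nonneg _) (R.le_opNorm _) 2
  have hs : Summable fun j => ‖(R ∘L V) (f j)‖ ^ 2 :=
    Summable.of_nonneg_of_le (fun j => sq_nonneg _) hb (hf.mul_left _)
  rw [e]
  refine ⟨_, ?_, hasTrace_comp_adjoint (R ∘L V) f hs⟩
  rw [← tsum_mul_left]
  exact hs.tsum_le_tsum hb (hf.mul_left _)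

theorem HasTrace.inner_le {S : E →L[ℝ] E} {t : ℝ} (hS : HasTrace S t)
    (hpos : ∀ x, 0 ≤ ⟪x, S x⟫_ℝ) (v : E) : ⟪v, S v⟫_ℝ ≤ t * ‖v‖ ^ 2 := by
  rcases eq_or_ne v 0 with rfl | hv
  · simp
  have hn : ‖v‖ ≠ 0 := norm_ne_zero_iff.2 hv
  set u : E := ‖v‖⁻¹ • v with hu
  have hu1 : ‖u‖ = 1 := by rw [hu, norm_smul, norm_inv, norm_norm, inv_mul_cancel₀ hn]
  have ho : Orthonormal ℝ ((↑) : ({u} : Set E) → E) :=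
    ⟨fun x => by rw [Set.mem_singleton_iff.1 x.2]; exact hu1,
      fun i j hij => (hij (Subsingleton.elim i j)).elim⟩
  obtain ⟨w, b, hw, hb⟩ := ho.exists_hilbertBasis_extension
  have h := le_hasSum (hS w b) ⟨u, hw rfl⟩ fun j _ => hpos _
  have hbu : b ⟨u, hw rfl⟩ = u := by rw [hb]
  rw [hbu, hu, map_smul, real_inner_smul_left, real_inner_smul_right] at h
  have h' := mul_le_mul_of_nonneg_right h (sq_nonneg ‖v‖)
  calc ⟪v, S v⟫_ℝ = ‖v‖⁻¹ * (‖v‖⁻¹ * ⟪v, S v⟫_ℝ) * ‖v‖ ^ 2 := by field_simp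
    _ ≤ _ := h'

/-- The top of the spectrum alone contributes `‖T‖ / (‖T‖ + lam) ≥ 1 / 2`. -/
theorem half_le_trace_comp_resolventAt (V : H →L[ℝ] E) (hlam : 0 < lam)
    (hle : lam ≤ ‖V ∘L V.adjoint‖) {t : ℝ}
    (ht : HasTrace ((V ∘L V.adjoint) * resolventAt (V ∘L V.adjoint) lam) t) : 1 / 2 ≤ t := by
  set T := V ∘L V.adjoint with hTdef
  have hT : T.IsPositive := ContinuousLinearMap.isPositive_self_comp_adjoint V
  have e1 : ∀ x, ⟪x, (T * resolventAt T lam) x⟫_ℝ =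
      ‖x‖ ^ 2 - lam * ⟪x, resolventAt T lam x⟫_ℝ := fun x => by
    change ⟪x, T (resolventAt T lam x)⟫_ℝ = _
    rw [eq_sub_of_add_eq (apply_resolventAt_add hT hlam x), inner_sub_right,
      real_inner_smul_right, real_inner_self_eq_norm_sq]
  have hpos : ∀ x, 0 ≤ ⟪x, (T * resolventAt T lam) x⟫_ℝ := fun x => by
    rw [e1]
    have := mul_le_mul_of_nonneg_left (inner_resolventAt_le hT hlam x) hlam.le
    rw [mul_inv_cancel_left₀ hlam.ne'] at this
    linarith
  have h1 := ht.inner_le hpos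
  by_contra! hlt
  have ht1 : 0 < 1 - t := by linarith
  have h2 : ∀ x, (1 - t) * ‖x‖ ≤ lam * ‖resolventAt T lam x‖ := fun x => by
    rcases eq_or_ne x 0 with rfl | hx
    · simp
    have hn : 0 < ‖x‖ := norm_pos_iff.2 hx
    have a := h1 x
    rw [e1] at a
    have b := real_inner_le_norm x (resolventAt T lam x)
    have c := mul_le_mul_of_nonneg_left b hlam.le
    refine le_of_mul_le_mul_right ?_ hn
    nlinarith
  have h3 : ∀ y, (1 - t) * ‖T y + lam • y‖ ≤ lam * ‖y‖ := fun y => by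
    simpa only [resolventAt_apply_add hT hlam] using h2 (T y + lam • y)
  set c := lam / (1 - t) - lam with hc
  have hc0 : c < lam := by
    rw [hc, sub_lt_iff_lt_add, div_lt_iff₀ ht1]
    nlinarith
  have hcn : 0 ≤ c := by
    have t0 : 0 ≤ t := by
      rcases subsingleton_or_nontrivial E with hE | hE
      · rw [Subsingleton.elim T 0, norm_zero] at hle
        exact absurd hle hlam.not_ge
      · obtain ⟨v, hv⟩ := exists_ne (0 : E)
        have := (hpos v).trans (h1 v)
        exact nonneg_of_mul_nonneg_left this (by positivity)
    rw [hc, sub_nonneg, le_div_iff₀ ht1]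
    nlinarith
  have h4 : ∀ y, ‖V.adjoint y‖ ≤ √c * ‖y‖ := fun y => by
    refine le_of_sq_le_sq ?_ (by positivity)
    rw [mul_pow, Real.sq_sqrt hcn]
    rcases eq_or_ne y 0 with rfl | hy
    · simp
    have a : ‖V.adjoint y‖ ^ 2 + lam * ‖y‖ ^ 2 = ⟪y, T y + lam • y⟫_ℝ := by
      rw [inner_add_right, real_inner_smul_right, real_inner_self_eq_norm_sq, hTdef,
        ContinuousLinearMap.comp_apply, ← ContinuousLinearMap.adjoint_inner_left,
        real_inner_self_eq_norm_sq]
    have b := real_inner_le_norm y (T y + lam • y)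
    have d : ‖T y + lam • y‖ ≤ lam / (1 - t) * ‖y‖ := by
      rw [div_mul_eq_mul_div, le_div_iff₀ ht1, mul_comm]
      exact h3 y
    nlinarith [mul_le_mul_of_nonneg_left d (norm_nonneg y)]
  have h5 : ‖T‖ ≤ c := by
    have h6 := ContinuousLinearMap.opNorm_le_bound _ (Real.sqrt_nonneg c) h4
    calc ‖T‖ ≤ ‖V‖ * ‖V.adjoint‖ := ContinuousLinearMap.opNorm_comp_le _ _
      _ = ‖V.adjoint‖ * ‖V.adjoint‖ := by rw [LinearIsometryEquiv.norm_map]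
      _ ≤ √c * √c := mul_le_mul h6 h6 (norm_nonneg _) (Real.sqrt_nonneg _)
      _ = c := Real.mul_self_sqrt hcn
  linarith

/-- By the tangent bound, `t₁` exceeds `t₂` by at most `lam * (s₁ - s₂) ≤ 1`, and `1 ≤ 2 * t₂`. -/
theorem trace_comp_resolventAt_le {T₁ : E →L[ℝ] E} (h₁ : T₁.IsPositive) (V : H →L[ℝ] E)
    (hlam : 0 < lam) (hle : lam ≤ ‖V ∘L V.adjoint‖) {t₁ t₂ s₁ s₂ : ℝ}
    (ht₁ : HasTrace (T₁ * resolventAt T₁ lam) t₁)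
    (ht₂ : HasTrace ((V ∘L V.adjoint) * resolventAt (V ∘L V.adjoint) lam) t₂)
    (hs₁ : HasTrace (resolventAt (V ∘L V.adjoint) lam * T₁ * resolventAt (V ∘L V.adjoint) lam) s₁)
    (hs₂ : HasTrace (resolventAt (V ∘L V.adjoint) lam * (V ∘L V.adjoint) *
      resolventAt (V ∘L V.adjoint) lam) s₂)
    (hs : s₁ ≤ s₂ + lam⁻¹) : t₁ ≤ 3 * t₂ := by
  have h₂ : (V ∘L V.adjoint).IsPositive := ContinuousLinearMap.isPositive_self_comp_adjoint V
  have hhalf := half_le_trace_comp_resolventAt V hlam hle ht₂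
  set T₂ := V ∘L V.adjoint
  obtain ⟨w, e, -⟩ := exists_hilbertBasis ℝ E
  have hle' : t₁ ≤ t₂ + lam * (s₁ - s₂) := by
    refine hasSum_le (fun i => ?_) (ht₁ w e)
      ((ht₂ w e).add (((hs₁ w e).sub (hs₂ w e)).mul_left lam))
    have h := inner_apply_resolventAt_le_tangent h₁ h₂ hlam (e i)
    rw [inner_resolventAt_comm h₂ hlam, inner_resolventAt_comm h₂ hlam] at h
    exact h
  have : lam * (s₁ - s₂) ≤ 1 := by
    calc lam * (s₁ - s₂) ≤ lam * lam⁻¹ := mul_le_mul_of_nonneg_left (by linarith) hlam.le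
      _ = 1 := mul_inv_cancel₀ hlam.ne'
  linarith

end Trace

/-! ### Reproducing kernel Hilbert spaces inside `L²` -/

section Embedding

variable {X : Type*} {H : Type*} [NormedAddCommGroup H] [InnerProductSpace ℝ H] [CompleteSpace H]
  [RKHS ℝ H X ℝ] {k : X → X → ℝ}

theorem RKHS.apply_eq_inner_kerFun (f : H) (x : X) : f x = ⟪RKHS.kerFun H x 1, f⟫_ℝ := by
  simp

theorem RKHS.norm_kerFun_one_sq (hk : ∀ x y, RKHS.kernel H x y 1 = k x y) (x : X) :
    ‖RKHS.kerFun H x 1‖ ^ 2 = k x x := by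
  rw [← real_inner_self_eq_norm_sq, ← RKHS.apply_eq_inner_kerFun, RKHS.kerFun_apply, hk]

theorem RKHS.abs_apply_le (hk : ∀ x y, RKHS.kernel H x y 1 = k x y) {C : ℝ} (f : H)
    {x : X} (hx : k x x ≤ C) : |f x| ≤ √C * ‖f‖ := by
  rw [RKHS.apply_eq_inner_kerFun]
  refine (abs_real_inner_le_norm _ _).trans (mul_le_mul_of_nonneg_right ?_ (norm_nonneg _))
  exact Real.le_sqrt_of_sq_le ((RKHS.norm_kerFun_one_sq hk x).trans_le hx)

theorem RKHS.abs_kernel_le (hk : ∀ x y, RKHS.kernel H x y 1 = k x y) {C : ℝ} (hC : 0 ≤ C)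
    {x y : X} (hx : k x x ≤ C) (hy : k y y ≤ C) : |k x y| ≤ C := by
  rw [← hk, ← RKHS.kerFun_apply]
  refine (RKHS.abs_apply_le hk _ hx).trans ?_
  have : ‖RKHS.kerFun H y 1‖ ≤ √C :=
    Real.le_sqrt_of_sq_le ((RKHS.norm_kerFun_one_sq hk y).trans_le hy)
  calc √C * ‖RKHS.kerFun H y 1‖ ≤ √C * √C := mul_le_mul_of_nonneg_left this (Real.sqrt_nonneg C)
    _ = C := Real.mul_self_sqrt hC

variable [MeasurableSpace X] {μ : Measure X}

/-- Convergence in `H` implies pointwise convergence, so the measurable elements form a closed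
subspace; it contains the kernel sections. -/
theorem RKHS.measurable_coe (hk : ∀ x y, RKHS.kernel H x y 1 = k x y)
    (hm : ∀ y, Measurable fun x => k x y) (f : H) : Measurable (f : X → ℝ) := by
  let S : Submodule ℝ H :=
    { carrier := {f | Measurable (f : X → ℝ)}
      add_mem' := fun {a b} ha hb => by
        change Measurable ((a + b : H) : X → ℝ)
        rw [RKHS.coe_add]
        exact Measurable.add ha hb
      zero_mem' := by
        change Measurable ((0 : H) : X → ℝ)
        rw [RKHS.coe_zero]
        exact measurable_zero
      smul_mem' := fun c a ha => by
        change Measurable ((c • a : H) : X → ℝ)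
        rw [RKHS.coe_smul]
        exact Measurable.const_smul ha c }
  have hS : IsClosed (S : Set H) := by
    refine isClosed_of_closure_subset fun f hf => ?_
    obtain ⟨u, hu, hlim⟩ := mem_closure_iff_seq_limit.1 hf
    refine measurable_of_tendsto_metrizable (f := fun n => (u n : X → ℝ)) hu ?_
    rw [tendsto_pi_nhds]
    exact fun x => ((RKHS.continuous_eval x).tendsto f).comp hlim
  have hspan : Submodule.span ℝ {RKHS.kerFun H x v | (x : X) (v : ℝ)} ≤ S := by
    refine Submodule.span_le.2 ?_
    rintro _ ⟨x, v, rfl⟩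
    have e : RKHS.kerFun H x v = v • RKHS.kerFun H x 1 := by
      rw [← map_smul, smul_eq_mul, mul_one]
    rw [e]
    refine S.smul_mem v ?_
    change Measurable fun y => RKHS.kerFun H x 1 y
    simp only [RKHS.kerFun_apply, hk]
    exact hm x
  have htop := Submodule.topologicalClosure_minimal _ hspan hS
  rw [RKHS.kerFun_dense] at htop
  exact htop trivial

theorem RKHS.memLp_coe [IsFiniteMeasure μ] (hk : ∀ x y, RKHS.kernel H x y 1 = k x y)
    (hm : ∀ y, Measurable fun x => k x y) {C : ℝ} (hb : ∀ᵐ x ∂μ, k x x ≤ C)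
    (f : H) : MemLp (f : X → ℝ) 2 μ :=
  MemLp.of_bound (RKHS.measurable_coe hk hm f).aestronglyMeasurable (√C * ‖f‖)
    (hb.mono fun _ hx => RKHS.abs_apply_le hk f hx)

/-- The inclusion of `H` into `L²(μ)` is a bounded operator. -/
theorem RKHS.exists_embedding [IsProbabilityMeasure μ] (hk : ∀ x y, RKHS.kernel H x y 1 = k x y)
    (hm : ∀ y, Measurable fun x => k x y) {C : ℝ} (hb : ∀ᵐ x ∂μ, k x x ≤ C) :
    ∃ V : H →L[ℝ] Lp ℝ 2 μ, ∀ f : H, V f =ᵐ[μ] f := by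
  have hL := RKHS.memLp_coe (H := H) hk hm hb
  let V₀ : H →ₗ[ℝ] Lp ℝ 2 μ :=
    { toFun := fun f => (hL f).toLp f
      map_add' := fun f g => by
        rw [← MemLp.toLp_add]
        exact MemLp.toLp_congr _ _ (by rw [RKHS.coe_add])
      map_smul' := fun c f => by
        rw [RingHom.id_apply, ← MemLp.toLp_const_smul]
        exact MemLp.toLp_congr _ _ (by rw [RKHS.coe_smul]) }
  refine ⟨V₀.mkContinuous (√C) fun f => ?_, fun f => (hL f).coeFn_toLp⟩
  have h := Lp.norm_le_of_ae_bound (f := (hL f).toLp f) (C := √C * ‖f‖) (by positivity) (by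
    filter_upwards [(hL f).coeFn_toLp, hb] with x h1 h2
    rw [h1]
    exact RKHS.abs_apply_le hk f h2)
  rwa [show measureUnivNNReal μ = 1 by simp [measureUnivNNReal], NNReal.coe_one, Real.one_rpow,
    one_mul] at h

variable {V : H →L[ℝ] Lp ℝ 2 μ}

theorem RKHS.adjoint_embedding_apply (hk : ∀ x y, RKHS.kernel H x y 1 = k x y)
    (hV : ∀ f : H, V f =ᵐ[μ] f) (u : Lp ℝ 2 μ) (y : X) :
    V.adjoint u y = ∫ x, u x * k x y ∂μ := by
  rw [RKHS.apply_eq_inner_kerFun, ContinuousLinearMap.adjoint_inner_right, L2.inner_def]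
  refine integral_congr_ae ?_
  filter_upwards [hV (RKHS.kerFun H y 1)] with x hx
  rw [hx, RKHS.kerFun_apply, hk]
  rfl

theorem RKHS.isIntegralOperator (hk : ∀ x y, RKHS.kernel H x y 1 = k x y)
    (hV : ∀ f : H, V f =ᵐ[μ] f) : IsIntegralOperator μ k (V ∘L V.adjoint) := by
  intro u
  filter_upwards [hV (V.adjoint u)] with y hy
  refine ⟨?_, by rw [ContinuousLinearMap.comp_apply, hy, RKHS.adjoint_embedding_apply hk hV]⟩
  refine (L2.integrable_inner (𝕜 := ℝ) (V (RKHS.kerFun H y 1)) u).congr ?_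
  filter_upwards [hV (RKHS.kerFun H y 1)] with x hx
  rw [hx, RKHS.kerFun_apply, hk]
  rfl

/-- The Hilbert–Schmidt norm of the embedding: `∑ ‖V e_j‖² ≤ ∫ k(x, x)`. -/
theorem RKHS.summable_norm_embedding_sq [IsProbabilityMeasure μ]
    (hk : ∀ x y, RKHS.kernel H x y 1 = k x y) (hm : ∀ y, Measurable fun x => k x y)
    {C : ℝ} (hb : ∀ᵐ x ∂μ, k x x ≤ C) (hV : ∀ f : H, V f =ᵐ[μ] f)
    {κ : Type*} (e : HilbertBasis κ ℝ H) :
    (Summable fun j => ‖V (e j)‖ ^ 2) ∧ ∑' j, ‖V (e j)‖ ^ 2 ≤ C := by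
  have h1 : ∀ f : H, ‖V f‖ ^ 2 = ∫ x, f x ^ 2 ∂μ := fun f => by
    rw [← real_inner_self_eq_norm_sq, L2.inner_def]
    refine integral_congr_ae ?_
    filter_upwards [hV f] with x hx
    rw [hx, real_inner_self_eq_norm_sq, Real.norm_eq_abs, sq_abs]
  have hi : ∀ f : H, Integrable (fun x => f x ^ 2) μ := fun f =>
    (RKHS.memLp_coe hk hm hb f).integrable_sq
  have hs : ∀ s : Finset κ, ∑ j ∈ s, ‖V (e j)‖ ^ 2 ≤ C := fun s => by
    simp only [h1]
    rw [← integral_finsetSum _ fun j _ => hi (e j)]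
    have h2 : ∫ x, ∑ j ∈ s, (e j) x ^ 2 ∂μ ≤ ∫ _, C ∂μ := by
      refine integral_mono_ae (integrable_finsetSum _ fun j _ => hi (e j)) (integrable_const C) ?_
      filter_upwards [hb] with x hx
      refine le_trans ?_ hx
      rw [← RKHS.norm_kerFun_one_sq hk x]
      refine le_trans (Finset.sum_le_sum fun j _ => ?_)
        (e.orthonormal.sum_inner_products_le (RKHS.kerFun H x 1) (s := s))
      rw [RKHS.apply_eq_inner_kerFun, real_inner_comm, Real.norm_eq_abs, sq_abs]
    simpa using h2
  exact ⟨summable_of_sum_le (fun j => sq_nonneg _) hs,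
    Real.tsum_le_of_sum_le (fun j => sq_nonneg _) hs⟩

theorem RKHS.exists_hasTrace_resolventAt [IsProbabilityMeasure μ]
    (hk : ∀ x y, RKHS.kernel H x y 1 = k x y) (hm : ∀ y, Measurable fun x => k x y)
    {C : ℝ} (hb : ∀ᵐ x ∂μ, k x x ≤ C) (hV : ∀ f : H, V f =ᵐ[μ] f)
    {lam : ℝ} (hlam : 0 < lam) :
    ∃ t, HasTrace ((V ∘L V.adjoint) * resolventAt (V ∘L V.adjoint) lam) t := by
  obtain ⟨w, e, -⟩ := exists_hilbertBasis ℝ H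
  exact hasTrace_comp_resolventAt V hlam e
    (RKHS.summable_norm_embedding_sq hk hm hb hV e).1

theorem RKHS.exists_hasTrace_conj [IsProbabilityMeasure μ]
    (hk : ∀ x y, RKHS.kernel H x y 1 = k x y) (hm : ∀ y, Measurable fun x => k x y)
    {C : ℝ} (hb : ∀ᵐ x ∂μ, k x x ≤ C) (hV : ∀ f : H, V f =ᵐ[μ] f)
    {R : Lp ℝ 2 μ →L[ℝ] Lp ℝ 2 μ} (hR : IsSelfAdjoint R) :
    ∃ t ≤ ‖R‖ ^ 2 * C, HasTrace (R * (V ∘L V.adjoint) * R) t := by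
  obtain ⟨w, e, -⟩ := exists_hilbertBasis ℝ H
  obtain ⟨h1, h2⟩ := RKHS.summable_norm_embedding_sq hk hm hb hV e
  obtain ⟨t, ht, h⟩ := hasTrace_conj V e h1 hR
  exact ⟨t, ht.trans (mul_le_mul_of_nonneg_left h2 (sq_nonneg _)), h⟩

end Embedding

section QuadraticForm

variable {X : Type*} [MeasurableSpace X] {μ : Measure X} [IsProbabilityMeasure μ] {k : X → X → ℝ}

/-- The quadratic form `∫∫ u(x) u(y) k(x, y)` of the integral operator with kernel `k`. -/
noncomputable def kernelForm (μ : Measure X) (k : X → X → ℝ) (u : X → ℝ) : ℝ :=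
  ∫ p : X × X, u p.1 * u p.2 * k p.1 p.2 ∂(μ.prod μ)

theorem integrable_mul_mul_kernel (hk : Measurable (Function.uncurry k)) {C : ℝ}
    (hb : ∀ᵐ p ∂(μ.prod μ), |k p.1 p.2| ≤ C) (u : Lp ℝ 2 μ) :
    Integrable (fun p : X × X => u p.1 * u p.2 * k p.1 p.2) (μ.prod μ) := by
  have hu : Integrable (u : X → ℝ) μ := (Lp.memLp u).integrable (by norm_num)
  exact (hu.mul_prod hu).mul_bdd (c := C) hk.aestronglyMeasurable hb

theorem IsIntegralOperator.inner_apply_self {T : Lp ℝ 2 μ →L[ℝ] Lp ℝ 2 μ}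
    (hT : IsIntegralOperator μ k T) (hk : Measurable (Function.uncurry k)) {C : ℝ}
    (hb : ∀ᵐ p ∂(μ.prod μ), |k p.1 p.2| ≤ C) (u : Lp ℝ 2 μ) :
    ⟪u, T u⟫_ℝ = kernelForm μ k u := by
  rw [kernelForm, integral_prod_symm _ (integrable_mul_mul_kernel hk hb u), L2.inner_def]
  refine integral_congr_ae ?_
  filter_upwards [hT u] with y hy
  change T u y * u y = _
  rw [hy.2, ← integral_mul_const]
  congr 1 with x
  ring

/-- The Hilbert–Schmidt norm dominates the operator norm. -/
theorem abs_kernelForm_le (hk : Measurable (Function.uncurry k)) {C : ℝ}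
    (hb : ∀ᵐ p ∂(μ.prod μ), |k p.1 p.2| ≤ C) (u : Lp ℝ 2 μ) :
    |kernelForm μ k u| ≤ √(∫ p, k p.1 p.2 ^ 2 ∂(μ.prod μ)) * ‖u‖ ^ 2 := by
  have hk2 : MemLp (fun p : X × X => k p.1 p.2) (ENNReal.ofReal 2) (μ.prod μ) :=
    MemLp.of_bound hk.aestronglyMeasurable C hb
  have hu2 : Integrable (fun x => u x ^ 2) μ := (Lp.memLp u).integrable_sq
  have hum : AEStronglyMeasurable (fun p : X × X => u p.1 * u p.2) (μ.prod μ) :=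
    ((Lp.memLp u).aestronglyMeasurable.comp_fst).mul ((Lp.memLp u).aestronglyMeasurable.comp_snd)
  have hw : MemLp (fun p : X × X => u p.1 * u p.2) 2 (μ.prod μ) := by
    rw [memLp_two_iff_integrable_sq hum]
    simpa only [mul_pow] using hu2.mul_prod hu2
  have h := integral_mul_norm_le_Lp_mul_Lq Real.HolderConjugate.two_two (μ := μ.prod μ)
    (f := fun p : X × X => k p.1 p.2) (g := fun p : X × X => u p.1 * u p.2) hk2
    (by simpa using hw)
  have hnorm : ‖u‖ ^ 2 = ∫ x, u x ^ 2 ∂μ := by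
    rw [← real_inner_self_eq_norm_sq, L2.inner_def]
    simp only [real_inner_self_eq_norm_sq, Real.norm_eq_abs, sq_abs]
  have e1 : ∫ p : X × X, (u p.1 * u p.2) ^ 2 ∂(μ.prod μ) = (‖u‖ ^ 2) ^ 2 := by
    simp only [mul_pow]
    rw [integral_prod_mul (fun x => u x ^ 2) (fun x => u x ^ 2), ← hnorm, ← sq]
  simp only [Real.norm_eq_abs, Real.rpow_two, sq_abs, ← Real.sqrt_eq_rpow, e1,
    Real.sqrt_sq (sq_nonneg ‖u‖)] at h
  refine le_trans (abs_integral_le_integral_abs) (le_trans (le_of_eq ?_) h)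
  congr 1 with p
  rw [abs_mul, mul_comm]

theorem kernelForm_average {Ω : Type*} {K : Ω → X → X → ℝ} {C : ℝ}
    (hK : ∀ ω, Measurable (Function.uncurry (K ω)))
    (hC : ∀ᵐ p ∂(μ.prod μ), ∀ ω, |K ω p.1 p.2| ≤ C) {m : ℕ} (b : Fin m → Ω) (u : Lp ℝ 2 μ) :
    kernelForm μ (fun x y => (m : ℝ)⁻¹ * ∑ r, K (b r) x y) u =
      (m : ℝ)⁻¹ * ∑ r, kernelForm μ (K (b r)) u := by
  simp only [kernelForm]
  rw [← integral_finsetSum _ fun r _ => integrable_mul_mul_kernel (hK (b r))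
    (hC.mono fun p hp => hp (b r)) u, ← integral_const_mul]
  congr 1 with p
  rw [← Finset.mul_sum]
  ring

end QuadraticForm

/-! ### Bayes rule and the regularized minimizer -/

section Risk

variable {α : Type*} [MeasurableSpace α] {𝒴 : Set ℝ} {ρ : Measure (α × 𝒴)}

theorem memLp_comp_fst {f : α → ℝ} (hf : MemLp f 2 ρ.fst) :
    MemLp (fun z : α × 𝒴 => f z.1) 2 ρ :=
  hf.comp_measurePreserving ⟨measurable_fst, rfl⟩

section Decomposition

variable [IsProbabilityMeasure ρ]

theorem memLp_label (hlabel : 𝒴 ⊆ Set.Icc (-1) 1) : MemLp (fun z : α × 𝒴 => (z.2 : ℝ)) 2 ρ := by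
  refine MemLp.of_bound (measurable_subtype_coe.comp measurable_snd).aestronglyMeasurable 1
    (Filter.Eventually.of_forall fun z => ?_)
  exact abs_le.2 (hlabel z.2.2)

theorem expectedRisk_eq_ofReal (hlabel : 𝒴 ⊆ Set.Icc (-1) 1) {f : α → ℝ}
    (hf : MemLp f 2 ρ.fst) :
    expectedRisk ρ f = ENNReal.ofReal (∫ z, 1 / 2 * (f z.1 - (z.2 : ℝ)) ^ 2 ∂ρ) := by
  rw [ofReal_integral_eq_lintegral_ofReal]
  · rfl
  · exact (((memLp_comp_fst hf).sub (memLp_label hlabel)).integrable_sq).const_mul _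
  · exact Filter.Eventually.of_forall fun z => by positivity

theorem integral_risk_add (hlabel : 𝒴 ⊆ Set.Icc (-1) 1) {f h : α → ℝ}
    (hf : MemLp f 2 ρ.fst) (hh : MemLp h 2 ρ.fst) (t : ℝ) :
    ∫ z, 1 / 2 * (f z.1 + t * h z.1 - (z.2 : ℝ)) ^ 2 ∂ρ =
      ∫ z, 1 / 2 * (f z.1 - (z.2 : ℝ)) ^ 2 ∂ρ + t * ∫ z, (f z.1 - (z.2 : ℝ)) * h z.1 ∂ρ +
        t ^ 2 / 2 * ∫ x, h x ^ 2 ∂ρ.fst := by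
  have h1 : MemLp (fun z : α × 𝒴 => f z.1 - (z.2 : ℝ)) 2 ρ :=
    (memLp_comp_fst hf).sub (memLp_label hlabel)
  have h2 := memLp_comp_fst (ρ := ρ) hh
  have i1 : Integrable (fun z : α × 𝒴 => 1 / 2 * (f z.1 - (z.2 : ℝ)) ^ 2) ρ :=
    h1.integrable_sq.const_mul _
  have i2 : Integrable (fun z : α × 𝒴 => (f z.1 - (z.2 : ℝ)) * h z.1) ρ := h1.integrable_mul h2
  have i3 : Integrable (fun z : α × 𝒴 => h z.1 ^ 2) ρ := h2.integrable_sq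
  have e : ∫ x, h x ^ 2 ∂ρ.fst = ∫ z, h z.1 ^ 2 ∂ρ :=
    integral_map measurable_fst.aemeasurable hh.integrable_sq.aestronglyMeasurable
  have i12 : Integrable (fun z : α × 𝒴 => 1 / 2 * (f z.1 - (z.2 : ℝ)) ^ 2 +
      t * ((f z.1 - (z.2 : ℝ)) * h z.1)) ρ := i1.add (i2.const_mul t)
  rw [e, ← integral_const_mul t, ← integral_const_mul (t ^ 2 / 2),
    ← integral_add i1 (i2.const_mul t), ← integral_add i12 (i3.const_mul _)]
  congr 1 with z
  ring

/-- First-order optimality of the Bayes rule: its residual is orthogonal to all square-integrable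
functions of the input. -/
theorem IsBayesRule.integral_residual_mul_eq_zero (hlabel : 𝒴 ⊆ Set.Icc (-1) 1) {g h : α → ℝ}
    (hg : IsBayesRule ρ g) (hgL : MemLp g 2 ρ.fst) (hh : Measurable h) (hhL : MemLp h 2 ρ.fst) :
    ∫ z, (g z.1 - (z.2 : ℝ)) * h z.1 ∂ρ = 0 := by
  set a := ∫ z, (g z.1 - (z.2 : ℝ)) * h z.1 ∂ρ with ha
  set b := ∫ x, h x ^ 2 ∂ρ.fst with hb
  have hb0 : 0 ≤ b := integral_nonneg fun x => sq_nonneg _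
  have key : ∀ t : ℝ, 0 ≤ t * a + t ^ 2 / 2 * b := fun t => by
    have h1 := hg.2 (fun x => g x + t * h x) (hg.1.add (hh.const_mul t))
    rw [expectedRisk_eq_ofReal hlabel hgL,
      expectedRisk_eq_ofReal (f := fun x => g x + t * h x) hlabel (hgL.add (hhL.const_mul t)),
      ENNReal.ofReal_le_ofReal_iff (integral_nonneg fun z => by positivity)] at h1
    have h2 := integral_risk_add hlabel hgL hhL t
    linarith
  have h1 := key (-a / (b + 1))
  have e : -a / (b + 1) * a + (-a / (b + 1)) ^ 2 / 2 * b =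
      -(a ^ 2 * (b / 2 + 1)) / (b + 1) ^ 2 := by
    field_simp
    ring
  rw [e] at h1
  have h2 : 0 ≤ -(a ^ 2 * (b / 2 + 1)) := by
    by_contra! hlt
    exact absurd h1 (not_le.2 (div_neg_of_neg_of_pos hlt (by positivity)))
  have h3 : a ^ 2 ≤ 0 := by nlinarith [sq_nonneg a, mul_nonneg (sq_nonneg a) hb0]
  exact pow_eq_zero_iff two_ne_zero |>.1 (le_antisymm h3 (sq_nonneg a))

/-- Excess risk is half the squared `L²` distance to the Bayes rule. -/
theorem IsBayesRule.expectedRisk_eq (hlabel : 𝒴 ⊆ Set.Icc (-1) 1) {g h : α → ℝ}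
    (hg : IsBayesRule ρ g) (hgL : MemLp g 2 ρ.fst) (hh : Measurable h) (hhL : MemLp h 2 ρ.fst)
    {G F : Lp ℝ 2 ρ.fst} (hG : G =ᵐ[ρ.fst] g) (hF : F =ᵐ[ρ.fst] h) :
    expectedRisk ρ h = ENNReal.ofReal
      (∫ z, 1 / 2 * (g z.1 - (z.2 : ℝ)) ^ 2 ∂ρ + 1 / 2 * ‖F - G‖ ^ 2) := by
  have h1 := integral_risk_add hlabel hgL (hhL.sub hgL) 1
  simp only [Pi.sub_apply] at h1
  have h0 := hg.integral_residual_mul_eq_zero hlabel hgL (hh.sub hg.1) (hhL.sub hgL)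
  simp only [Pi.sub_apply] at h0
  have h2 : ∫ x, (h x - g x) ^ 2 ∂ρ.fst = ‖F - G‖ ^ 2 := by
    rw [← real_inner_self_eq_norm_sq, L2.inner_def]
    refine integral_congr_ae ?_
    filter_upwards [Lp.coeFn_sub F G, hG, hF] with x hx hxG hxF
    rw [real_inner_self_eq_norm_sq, hx, Pi.sub_apply, hxG, hxF, Real.norm_eq_abs, sq_abs]
  rw [expectedRisk_eq_ofReal hlabel hhL]
  congr 1
  rw [h0, h2] at h1
  simp only [one_mul, add_sub_cancel] at h1
  rw [h1]
  ring

end Decomposition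

variable {H : Type*} [NormedAddCommGroup H] [InnerProductSpace ℝ H] [CompleteSpace H]

/-- Completing the square around `Vᵀ (V Vᵀ + lam)⁻¹ G`. -/
theorem ridge_objective_eq {E : Type*} [NormedAddCommGroup E] [InnerProductSpace ℝ E]
    [CompleteSpace E] (V : H →L[ℝ] E) {lam : ℝ} (hlam : 0 < lam) (G : E) (h : H) :
    1 / 2 * ‖V h - G‖ ^ 2 + lam / 2 * ‖h‖ ^ 2 =
      1 / 2 * ‖V (V.adjoint (resolventAt (V ∘L V.adjoint) lam G)) - G‖ ^ 2 +
        lam / 2 * ‖V.adjoint (resolventAt (V ∘L V.adjoint) lam G)‖ ^ 2 +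
        (1 / 2 * ‖V (h - V.adjoint (resolventAt (V ∘L V.adjoint) lam G))‖ ^ 2 +
          lam / 2 * ‖h - V.adjoint (resolventAt (V ∘L V.adjoint) lam G)‖ ^ 2) := by
  have hT : (V ∘L V.adjoint).IsPositive := ContinuousLinearMap.isPositive_self_comp_adjoint V
  set u := resolventAt (V ∘L V.adjoint) lam G with hu
  have e : V (V.adjoint u) + lam • u = G := apply_resolventAt_add hT hlam G
  set g := V.adjoint u with hg
  obtain ⟨v, rfl⟩ : ∃ v, h = g + v := ⟨h - g, by abel⟩
  have e1 : V g - G = -(lam • u) := by rw [← e]; abel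
  have e2 : V (g + v) - G = V v - lam • u := by rw [map_add, ← e]; abel
  have e3 : ⟪g, v⟫_ℝ = ⟪V v, u⟫_ℝ := by
    rw [hg, ContinuousLinearMap.adjoint_inner_left, real_inner_comm]
  rw [e1, e2, add_sub_cancel_left, norm_neg, norm_sub_sq_real, norm_add_sq_real,
    real_inner_smul_right, e3]
  ring

/-- Kernel ridge regression: `r` is the Bayes risk and `G` the class of the Bayes rule. -/
theorem isRegularizedMinimizer_ridge [RKHS ℝ H α ℝ] (V : H →L[ℝ] Lp ℝ 2 ρ.fst) {lam : ℝ}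
    (hlam : 0 < lam) (G : Lp ℝ 2 ρ.fst) {r : ℝ} (hr : 0 ≤ r)
    (hL : ∀ h : H, expectedRisk ρ h = ENNReal.ofReal (r + 1 / 2 * ‖V h - G‖ ^ 2)) :
    IsRegularizedMinimizer ρ lam (V.adjoint (resolventAt (V ∘L V.adjoint) lam G)) ∧
      ∀ h : H, IsRegularizedMinimizer ρ lam h →
        h = V.adjoint (resolventAt (V ∘L V.adjoint) lam G) := by
  set g := V.adjoint (resolventAt (V ∘L V.adjoint) lam G) with hg
  have hobj : ∀ h : H, expectedRisk ρ h + ENNReal.ofReal (lam / 2 * ‖h‖ ^ 2) =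
      ENNReal.ofReal (r + (1 / 2 * ‖V g - G‖ ^ 2 + lam / 2 * ‖g‖ ^ 2 +
        (1 / 2 * ‖V (h - g)‖ ^ 2 + lam / 2 * ‖h - g‖ ^ 2))) := fun h => by
    rw [hL, ← ENNReal.ofReal_add (by positivity) (by positivity), add_assoc r,
      ridge_objective_eq V hlam G h]
  constructor
  · intro h
    rw [hobj, hobj]
    refine ENNReal.ofReal_le_ofReal ?_
    have : 0 ≤ 1 / 2 * ‖V (h - g)‖ ^ 2 + lam / 2 * ‖h - g‖ ^ 2 := by positivity
    simp only [sub_self, map_zero, norm_zero]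
    linarith
  · intro h hh
    have h1 := hh g
    rw [hobj, hobj, ENNReal.ofReal_le_ofReal_iff (by positivity)] at h1
    simp only [sub_self, map_zero, norm_zero] at h1
    have h2 : lam / 2 * ‖h - g‖ ^ 2 ≤ 0 := by nlinarith [sq_nonneg ‖V (h - g)‖]
    have h3 : ‖h - g‖ ^ 2 ≤ 0 := by
      by_contra! hlt
      exact absurd h2 (not_le.2 (by positivity))
    have h4 : ‖h - g‖ = 0 := pow_eq_zero_iff two_ne_zero |>.1 (le_antisymm h3 (sq_nonneg _))
    exact sub_eq_zero.1 (norm_eq_zero.1 h4)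

end Risk

/-! ### Concentration of empirical averages -/

section Concentration

open ProbabilityTheory

variable {Ω : Type*} [MeasurableSpace Ω] {ν : Measure Ω} [IsProbabilityMeasure ν]

/-- The variance of an average of `m` independent copies is `1 / m` times the variance of one. -/
theorem lintegral_pi_average_sub_sq_le {f : Ω → ℝ} (hf : Measurable f) {C : ℝ}
    (hC : ∀ ω, |f ω| ≤ C) {m : ℕ} (hm : 0 < m) :
    ∫⁻ b : Fin m → Ω, ENNReal.ofReal (((m : ℝ)⁻¹ * ∑ r, f (b r) - ∫ ω, f ω ∂ν) ^ 2)
      ∂(Measure.pi fun _ => ν) ≤ ENNReal.ofReal (C ^ 2 / m) := by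
  have hm' : (m : ℝ) ≠ 0 := by positivity
  have hL : MemLp f 2 ν :=
    MemLp.of_bound hf.aestronglyMeasurable C (Filter.Eventually.of_forall hC)
  set S : (Fin m → Ω) → ℝ := fun b => (m : ℝ)⁻¹ * ∑ r, f (b r) with hS
  have hSL : MemLp S 2 (Measure.pi fun _ : Fin m => ν) := by
    have h : MemLp (fun b : Fin m → Ω => ∑ r, f (b r)) 2 (Measure.pi fun _ : Fin m => ν) :=
      memLp_finsetSum Finset.univ (f := fun r (b : Fin m → Ω) => f (b r)) fun r _ =>
        hL.comp_measurePreserving (measurePreserving_eval (fun _ => ν) r)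
    exact h.const_mul _
  have hmean : ∫ b, S b ∂(Measure.pi fun _ : Fin m => ν) = ∫ ω, f ω ∂ν := by
    rw [hS, integral_const_mul, integral_finsetSum]
    · simp only [integral_comp_eval (μ := fun _ : Fin m => ν) hf.aestronglyMeasurable]
      simp [hm']
    · exact fun r _ => integrable_comp_eval (hL.integrable (by norm_num))
  have hvar : Var[S; Measure.pi fun _ : Fin m => ν] ≤ C ^ 2 / m := by
    have h1 := variance_sum_pi (μ := fun _ : Fin m => ν) (X := fun _ => f) fun _ => hL
    have e : S = fun b => (m : ℝ)⁻¹ * (∑ r : Fin m, fun b : Fin m → Ω => f (b r)) b := by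
      ext b
      simp [hS]
    rw [e, variance_const_mul, h1, Finset.sum_const, Finset.card_univ, Fintype.card_fin,
      nsmul_eq_mul]
    have h2 : Var[f; ν] ≤ C ^ 2 := by
      refine (variance_le_expectation_sq hf.aestronglyMeasurable).trans ?_
      have h3 : ∫ ω, (f ^ 2) ω ∂ν ≤ ∫ _, C ^ 2 ∂ν :=
        integral_mono hL.integrable_sq (integrable_const _) fun ω => sq_le_sq' (abs_le.1 (hC ω)).1
          (abs_le.1 (hC ω)).2
      simpa using h3
    calc (m : ℝ)⁻¹ ^ 2 * (m * Var[f; ν]) = Var[f; ν] / m := by field_simp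
      _ ≤ C ^ 2 / m := by gcongr
  rw [variance_eq_integral hSL.aestronglyMeasurable.aemeasurable, hmean] at hvar
  rw [← ofReal_integral_eq_lintegral_ofReal]
  · exact ENNReal.ofReal_le_ofReal hvar
  · exact (hSL.sub (memLp_const (∫ ω, f ω ∂ν))).integrable_sq
  · exact Filter.Eventually.of_forall fun b => sq_nonneg _

/-- Chebyshev's inequality for the upper deviation of an average of independent copies. -/
theorem measure_pi_average_ge_le {f : Ω → ℝ} (hf : Measurable f) {C : ℝ}
    (hC : ∀ ω, |f ω| ≤ C) {m : ℕ} (hm : 0 < m) {ε : ℝ} (hε : 0 < ε) :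
    (Measure.pi fun _ : Fin m => ν) {b | ∫ ω, f ω ∂ν + ε ≤ (m : ℝ)⁻¹ * ∑ r, f (b r)} ≤
      ENNReal.ofReal (C ^ 2 / m) / ENNReal.ofReal (ε ^ 2) := by
  have hmeas : Measurable fun b : Fin m → Ω =>
      ENNReal.ofReal (((m : ℝ)⁻¹ * ∑ r, f (b r) - ∫ ω, f ω ∂ν) ^ 2) := by
    refine ENNReal.measurable_ofReal.comp (Measurable.pow_const (Measurable.sub_const
      (Measurable.const_mul (Finset.measurable_fun_sum _ fun r _ => ?_) _) _) _)
    exact hf.comp (measurable_pi_apply r)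
  refine le_trans (measure_mono ?_) ((meas_ge_le_lintegral_div hmeas.aemeasurable
    (by simpa using hε.ne') ENNReal.ofReal_ne_top).trans
      (ENNReal.div_le_div_right (lintegral_pi_average_sub_sq_le hf hC hm) _))
  intro b hb
  refine ENNReal.ofReal_le_ofReal (pow_le_pow_left₀ hε.le ?_ 2)
  have hb' : ∫ ω, f ω ∂ν + ε ≤ (m : ℝ)⁻¹ * ∑ r, f (b r) := hb
  linarith

variable {X : Type*} [MeasurableSpace X] {μ : Measure X} [IsProbabilityMeasure μ]
  {K : Ω → X → X → ℝ}

theorem measurable_integral_kernel (hK : Measurable fun p : Ω × X × X => K p.1 p.2.1 p.2.2) :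
    Measurable (Function.uncurry fun x y => ∫ ω, K ω x y ∂ν) := by
  have h : StronglyMeasurable fun p : (X × X) × Ω => K p.2 p.1.1 p.1.2 :=
    (hK.comp (measurable_snd.prodMk measurable_fst)).stronglyMeasurable
  exact h.integral_prod_right'.measurable

/-- The random kernel concentrates around its mean in `L²(μ ⊗ μ)`. -/
theorem measure_pi_kernel_sub_sq_ge_le
    (hK : Measurable fun p : Ω × X × X => K p.1 p.2.1 p.2.2) {C : ℝ}
    (hC : ∀ᵐ p ∂(μ.prod μ), ∀ ω, |K ω p.1 p.2| ≤ C) {m : ℕ} (hm : 0 < m) {ε : ℝ} (hε : 0 < ε) :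
    (Measure.pi fun _ : Fin m => ν) {b | ε ≤ ∫ p : X × X,
        ((m : ℝ)⁻¹ * ∑ r, K (b r) p.1 p.2 - ∫ ω, K ω p.1 p.2 ∂ν) ^ 2 ∂(μ.prod μ)} ≤
      ENNReal.ofReal (C ^ 2 / m) / ENNReal.ofReal ε := by
  set D : (Fin m → Ω) → X × X → ℝ := fun b p =>
    ((m : ℝ)⁻¹ * ∑ r, K (b r) p.1 p.2 - ∫ ω, K ω p.1 p.2 ∂ν) ^ 2 with hD
  have hDm : Measurable fun q : (Fin m → Ω) × X × X => ENNReal.ofReal (D q.1 q.2) := by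
    refine ENNReal.measurable_ofReal.comp (Measurable.pow_const (Measurable.sub
      (Measurable.const_mul (Finset.measurable_fun_sum _ fun r _ => ?_) _) ?_) _)
    · have hr : Measurable fun q : (Fin m → Ω) × X × X => (q.1 r, q.2) :=
        ((measurable_pi_apply r).comp measurable_fst).prodMk measurable_snd
      exact hK.comp hr
    · exact (measurable_integral_kernel hK).comp measurable_snd
  have hle : ∫⁻ b, ∫⁻ p, ENNReal.ofReal (D b p) ∂(μ.prod μ) ∂(Measure.pi fun _ : Fin m => ν) ≤
      ENNReal.ofReal (C ^ 2 / m) := by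
    rw [lintegral_lintegral_swap hDm.aemeasurable]
    calc ∫⁻ p, ∫⁻ b, ENNReal.ofReal (D b p) ∂(Measure.pi fun _ : Fin m => ν) ∂(μ.prod μ)
        ≤ ∫⁻ _, ENNReal.ofReal (C ^ 2 / m) ∂(μ.prod μ) := by
          refine lintegral_mono_ae ?_
          filter_upwards [hC] with p hp
          refine lintegral_pi_average_sub_sq_le (f := fun ω => K ω p.1 p.2) ?_ hp hm
          exact hK.comp (measurable_id.prodMk measurable_const)
      _ = ENNReal.ofReal (C ^ 2 / m) := by simp
  refine le_trans (measure_mono ?_) ((meas_ge_le_lintegral_div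
    hDm.lintegral_prod_right'.aemeasurable (by simpa using hε) ENNReal.ofReal_ne_top).trans
      (ENNReal.div_le_div_right hle _))
  intro b hb
  have hb' : ε ≤ ∫ p, D b p ∂(μ.prod μ) := hb
  refine (ENNReal.ofReal_le_ofReal hb').trans ?_
  have hDb : Measurable (D b) := by
    refine Measurable.pow_const (Measurable.sub
      (Measurable.const_mul (Finset.measurable_fun_sum _ fun r _ => ?_) _) ?_) _
    · exact hK.comp (measurable_const.prodMk measurable_id)
    · exact measurable_integral_kernel hK
  rw [integral_eq_lintegral_of_nonneg_ae (Filter.Eventually.of_forall fun p => sq_nonneg _)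
    hDb.aestronglyMeasurable]
  exact ENNReal.ofReal_toReal_le

theorem measurable_kernelForm (hK : Measurable fun p : Ω × X × X => K p.1 p.2.1 p.2.2)
    (u : Lp ℝ 2 μ) : Measurable fun ω => kernelForm μ (K ω) u := by
  have hu : Measurable (u : X → ℝ) := (Lp.stronglyMeasurable u).measurable
  have h : Measurable fun q : Ω × X × X => u q.2.1 * u q.2.2 * K q.1 q.2.1 q.2.2 :=
    ((hu.comp (measurable_fst.comp measurable_snd)).mul
      (hu.comp (measurable_snd.comp measurable_snd))).mul hK
  exact h.stronglyMeasurable.integral_prod_right'.measurable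

theorem integrable_kernelForm_and_integral_eq
    (hK : Measurable fun p : Ω × X × X => K p.1 p.2.1 p.2.2) {C : ℝ}
    (hC : ∀ᵐ p ∂(μ.prod μ), ∀ ω, |K ω p.1 p.2| ≤ C) (u : Lp ℝ 2 μ) :
    Integrable (fun ω => kernelForm μ (K ω) u) ν ∧
      ∫ ω, kernelForm μ (K ω) u ∂ν = kernelForm μ (fun x y => ∫ ω, K ω x y ∂ν) u := by
  have hu : Integrable (u : X → ℝ) μ := (Lp.memLp u).integrable (by norm_num)
  have h1 : Integrable (fun q : Ω × X × X => u q.2.1 * u q.2.2 * K q.1 q.2.1 q.2.2)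
      (ν.prod (μ.prod μ)) := by
    refine ((hu.mul_prod hu).comp_snd ν).mul_bdd (c := C) hK.aestronglyMeasurable ?_
    filter_upwards [Measure.quasiMeasurePreserving_snd.ae hC] with q hq
    exact hq q.1
  refine ⟨h1.integral_prod_left, ?_⟩
  simp only [kernelForm]
  rw [integral_integral_swap h1]
  congr 1 with p
  rw [integral_const_mul]

/-- Traces commute with averaging over the random kernel. -/
theorem integral_trace_eq (hK : Measurable fun p : Ω × X × X => K p.1 p.2.1 p.2.2) {C : ℝ}
    (hC : ∀ᵐ p ∂(μ.prod μ), ∀ ω, |K ω p.1 p.2| ≤ C) {ι : Type*} [Countable ι]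
    {u : ι → Lp ℝ 2 μ} (hpos : ∀ ω i, 0 ≤ kernelForm μ (K ω) (u i)) {ψ : Ω → ℝ}
    (hψ : ∀ ω, HasSum (fun i => kernelForm μ (K ω) (u i)) (ψ ω)) {s : ℝ}
    (hs : HasSum (fun i => kernelForm μ (fun x y => ∫ ω, K ω x y ∂ν) (u i)) s) :
    Measurable ψ ∧ ∫ ω, ψ ω ∂ν = s := by
  have hψe : ψ = fun ω => ∑' i, kernelForm μ (K ω) (u i) := funext fun ω => (hψ ω).tsum_eq.symm
  have h1 := fun i => integrable_kernelForm_and_integral_eq (ν := ν) hK hC (u i)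
  constructor
  · have e : ψ = fun ω => (∑' i, ENNReal.ofReal (kernelForm μ (K ω) (u i))).toReal := by
      ext ω
      rw [← ENNReal.ofReal_tsum_of_nonneg (hpos ω) (hψ ω).summable, (hψ ω).tsum_eq,
        ENNReal.toReal_ofReal ((hψ ω).nonneg (hpos ω))]
    rw [e]
    exact (Measurable.tsum fun i => ENNReal.measurable_ofReal.comp
      (measurable_kernelForm hK (u i))).ennreal_toReal
  · have h2 := hasSum_integral_of_summable_integral_norm (F := fun i ω => kernelForm μ (K ω) (u i))
      (fun i => (h1 i).1) (by
        refine hs.summable.congr fun i => ?_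
        rw [← (h1 i).2]
        refine integral_congr_ae (Filter.Eventually.of_forall fun ω => ?_)
        exact (Real.norm_of_nonneg (hpos ω i)).symm)
    rw [← hψe] at h2
    refine h2.unique ?_
    simpa only [(h1 _).2] using hs

end Concentration

/-! ### The random feature kernels -/

section Kernels

variable {d : ℕ} {σ : ℝ → ℝ} {γ : ℝ}

theorem isProbabilityMeasure_uniformSphere (hd : 0 < d) :
    IsProbabilityMeasure (uniformSphere d) := by
  have : Nonempty (Fin d) := ⟨⟨0, hd⟩⟩
  refine ⟨?_⟩
  rw [uniformSphere, Measure.smul_apply, smul_eq_mul]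
  refine ENNReal.inv_mul_cancel ?_ (measure_ne_top _ _)
  rw [Ne, Measure.measure_univ_eq_zero]
  exact Measure.toSphere_ne_zero _

/-- The kernel of a single neuron with hidden weight `b`. -/
noncomputable def neuronKernel (σ : ℝ → ℝ) (γ : ℝ) (b : sphere (0 : EuclideanSpace ℝ (Fin d)) 1)
    (x y : EuclideanSpace ℝ (Fin d)) : ℝ :=
  σ ⟪(b : EuclideanSpace ℝ (Fin d)), x⟫_ℝ * σ ⟪(b : EuclideanSpace ℝ (Fin d)), y⟫_ℝ +
    (⟪x, y⟫_ℝ + γ ^ 2) * (deriv σ ⟪(b : EuclideanSpace ℝ (Fin d)), x⟫_ℝ *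
      deriv σ ⟪(b : EuclideanSpace ℝ (Fin d)), y⟫_ℝ)

theorem rfKernel_one (b : Fin 1 → sphere (0 : EuclideanSpace ℝ (Fin d)) 1)
    (x y : EuclideanSpace ℝ (Fin d)) : rfKernel σ γ b x y = neuronKernel σ γ (b 0) x y := by
  simp [rfKernel, neuronKernel]

/-- Repeating the weights does not change the average, so `k_M` averages `m = M / 2` independent
single-neuron kernels. -/
theorem rfKernel_symInit {m : ℕ} (b : Fin m → sphere (0 : EuclideanSpace ℝ (Fin d)) 1)
    (x y : EuclideanSpace ℝ (Fin d)) :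
    rfKernel σ γ (symInit b) x y = (m : ℝ)⁻¹ * ∑ r, neuronKernel σ γ (b r) x y := by
  rcases Nat.eq_zero_or_pos m with rfl | hm
  · simp [rfKernel]
  have hm' : (m : ℝ) ≠ 0 := by positivity
  simp only [rfKernel, neuronKernel, symInit, Fin.sum_univ_add, Fin.append_left, Fin.append_right,
    Finset.sum_add_distrib, ← Finset.mul_sum, Nat.cast_add]
  field_simp

theorem continuous_neuronKernel (hσ : ActivationAssumption σ) :
    Continuous fun p : sphere (0 : EuclideanSpace ℝ (Fin d)) 1 × EuclideanSpace ℝ (Fin d) ×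
      EuclideanSpace ℝ (Fin d) => neuronKernel σ γ p.1 p.2.1 p.2.2 := by
  have h1 := hσ.differentiable.continuous
  have h2 := hσ.differentiable_deriv.continuous
  unfold neuronKernel
  fun_prop

theorem ntk_eq_integral (hd : 0 < d) (hσ : ActivationAssumption σ)
    (x y : EuclideanSpace ℝ (Fin d)) :
    ntk σ γ x y = ∫ b, neuronKernel σ γ b x y ∂(uniformSphere d) := by
  have := isProbabilityMeasure_uniformSphere hd
  have h1 := hσ.differentiable.continuous
  have h2 := hσ.differentiable_deriv.continuous
  simp only [neuronKernel]
  rw [integral_add, integral_const_mul, ntk]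
  · exact Continuous.integrable_of_hasCompactSupport (by fun_prop) (.of_compactSpace _)
  · exact Continuous.integrable_of_hasCompactSupport (by fun_prop) (.of_compactSpace _)

theorem neuronKernel_self_le (hσ : ActivationAssumption σ) (hγ : γ ∈ Set.Icc (0 : ℝ) 1)
    (b : sphere (0 : EuclideanSpace ℝ (Fin d)) 1) {x : EuclideanSpace ℝ (Fin d)}
    (hx : ‖x‖ ≤ 1) : neuronKernel σ γ b x x ≤ 12 := by
  have hb : ‖(b : EuclideanSpace ℝ (Fin d))‖ = 1 := norm_eq_of_mem_sphere b
  set t := ⟪(b : EuclideanSpace ℝ (Fin d)), x⟫_ℝ with ht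
  have h1 : |t| ≤ 1 := by
    have := abs_real_inner_le_norm (b : EuclideanSpace ℝ (Fin d)) x
    rw [hb, one_mul] at this
    exact this.trans hx
  have h2 : |σ t| ≤ 2 := (hσ.abs_le t).trans (by linarith)
  have h3 : σ t ^ 2 ≤ 4 := by
    rw [← sq_abs]
    nlinarith [abs_nonneg (σ t)]
  have h4 : deriv σ t ^ 2 ≤ 4 := by
    rw [← sq_abs]
    nlinarith [abs_nonneg (deriv σ t), hσ.abs_deriv_le t]
  have h5 : ‖x‖ ^ 2 + γ ^ 2 ≤ 2 := by nlinarith [norm_nonneg x, hγ.1, hγ.2]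
  rw [neuronKernel, real_inner_self_eq_norm_sq, ← ht, ← sq, ← sq]
  nlinarith [mul_le_mul h5 h4 (sq_nonneg _) zero_le_two]

theorem kernel_rfSpace {M : ℕ} (𝒳 : Set (EuclideanSpace ℝ (Fin d)))
    (b : Fin M → sphere (0 : EuclideanSpace ℝ (Fin d)) 1) (x y : 𝒳) :
    RKHS.kernel (RFSpace 𝒳 σ γ b) x y 1 = rfKernel σ γ b x y := by
  rw [RKHS.OfKernel.kernel_ofKernel]
  simp [kernelMatrix]

theorem ae_norm_le_one_of_support {𝒳 : Set (EuclideanSpace ℝ (Fin d))} {μ : Measure 𝒳}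
    (h : (μ.map Subtype.val).support ⊆ closedBall (0 : EuclideanSpace ℝ (Fin d)) 1) :
    ∀ᵐ x : 𝒳 ∂μ, ‖(x : EuclideanSpace ℝ (Fin d))‖ ≤ 1 := by
  have h0 : (μ.map Subtype.val).support ∈ ae (μ.map Subtype.val) := Measure.support_mem_ae
  exact ae_of_ae_map measurable_subtype_coe.aemeasurable
    (Filter.mem_of_superset h0 fun z hz => by simpa using h hz)

end Kernels

/-! ### Finite width against infinite width -/

section Comparison

variable {d : ℕ} {σ : ℝ → ℝ} {γ : ℝ} {𝒳 : Set (EuclideanSpace ℝ (Fin d))} {μ : Measure 𝒳}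

theorem measurable_rfKernel (hσ : ActivationAssumption σ) {M : ℕ}
    (b : Fin M → sphere (0 : EuclideanSpace ℝ (Fin d)) 1) :
    Measurable (Function.uncurry fun x y : 𝒳 => rfKernel σ γ b x y) := by
  have h1 := hσ.differentiable.continuous
  have h2 := hσ.differentiable_deriv.continuous
  have h : Continuous (Function.uncurry fun x y : 𝒳 => rfKernel σ γ b x y) := by
    unfold rfKernel Function.uncurry
    fun_prop
  exact h.measurable

theorem measurable_neuronKernel (hσ : ActivationAssumption σ) :
    Measurable fun p : sphere (0 : EuclideanSpace ℝ (Fin d)) 1 × 𝒳 × 𝒳 =>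
      neuronKernel σ γ p.1 p.2.1 p.2.2 :=
  ((continuous_neuronKernel hσ).comp (by fun_prop :
    Continuous fun p : sphere (0 : EuclideanSpace ℝ (Fin d)) 1 × 𝒳 × 𝒳 =>
      (p.1, (p.2.1 : EuclideanSpace ℝ (Fin d)), (p.2.2 : EuclideanSpace ℝ (Fin d))))).measurable

theorem ae_prod_abs_neuronKernel_le [IsProbabilityMeasure μ] (hσ : ActivationAssumption σ)
    (hγ : γ ∈ Set.Icc (0 : ℝ) 1) (hμ : ∀ᵐ x : 𝒳 ∂μ, ‖(x : EuclideanSpace ℝ (Fin d))‖ ≤ 1) :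
    ∀ᵐ p ∂(μ.prod μ), ∀ b, |neuronKernel (d := d) σ γ b p.1 p.2| ≤ 12 := by
  filter_upwards [Measure.quasiMeasurePreserving_fst.ae hμ,
    Measure.quasiMeasurePreserving_snd.ae hμ] with p h1 h2 b
  have hk : ∀ x y : 𝒳, RKHS.kernel (RFSpace 𝒳 σ γ fun _ : Fin 1 => b) x y 1 =
      neuronKernel σ γ b x y := fun x y => by rw [kernel_rfSpace, rfKernel_one]
  exact RKHS.abs_kernel_le (k := fun x y : 𝒳 => neuronKernel σ γ b x y) hk (by norm_num)
    (neuronKernel_self_le hσ hγ b h1) (neuronKernel_self_le hσ hγ b h2)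

theorem ae_prod_abs_ntk_le (hd : 0 < d) [IsProbabilityMeasure μ] (hσ : ActivationAssumption σ)
    (hγ : γ ∈ Set.Icc (0 : ℝ) 1) (hμ : ∀ᵐ x : 𝒳 ∂μ, ‖(x : EuclideanSpace ℝ (Fin d))‖ ≤ 1) :
    ∀ᵐ p ∂(μ.prod μ), |ntk (d := d) σ γ p.1 p.2| ≤ 12 := by
  have := isProbabilityMeasure_uniformSphere hd
  filter_upwards [ae_prod_abs_neuronKernel_le hσ hγ hμ] with p hp
  rw [ntk_eq_integral hd hσ]
  simpa using norm_integral_le_of_norm_le_const (μ := uniformSphere d)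
    (f := fun b => neuronKernel σ γ b p.1 p.2) (.of_forall hp)

theorem rfKernel_symInit_self_le (hσ : ActivationAssumption σ) (hγ : γ ∈ Set.Icc (0 : ℝ) 1)
    {m : ℕ} (b : Fin m → sphere (0 : EuclideanSpace ℝ (Fin d)) 1)
    {x : EuclideanSpace ℝ (Fin d)} (hx : ‖x‖ ≤ 1) : rfKernel σ γ (symInit b) x x ≤ 12 := by
  rw [rfKernel_symInit]
  have h : ∑ r, neuronKernel σ γ (b r) x x ≤ m * 12 := by
    simpa using Finset.sum_le_sum fun r (_ : r ∈ Finset.univ) => neuronKernel_self_le hσ hγ (b r) hx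
  rcases Nat.eq_zero_or_pos m with rfl | hm
  · simp
  · rw [inv_mul_le_iff₀ (by positivity)]
    exact h

theorem ntk_self_le (hd : 0 < d) (hσ : ActivationAssumption σ) (hγ : γ ∈ Set.Icc (0 : ℝ) 1)
    {x : EuclideanSpace ℝ (Fin d)} (hx : ‖x‖ ≤ 1) : ntk σ γ x x ≤ 12 := by
  have := isProbabilityMeasure_uniformSphere hd
  rw [ntk_eq_integral hd hσ]
  have hc : Continuous fun b : sphere (0 : EuclideanSpace ℝ (Fin d)) 1 => neuronKernel σ γ b x x :=
    (continuous_neuronKernel hσ).comp (by fun_prop : Continuous fun b => (b, x, x))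
  have h : ∫ b, neuronKernel σ γ b x x ∂(uniformSphere d) ≤ ∫ _, (12 : ℝ) ∂(uniformSphere d) :=
    integral_mono (hc.integrable_of_hasCompactSupport (.of_compactSpace _)) (integrable_const _)
      fun b => neuronKernel_self_le hσ hγ b hx
  simpa using h

theorem measurable_ntk (hd : 0 < d) (hσ : ActivationAssumption σ) :
    Measurable (Function.uncurry fun x y : 𝒳 => ntk (d := d) σ γ x y) := by
  have := isProbabilityMeasure_uniformSphere hd
  have e : (fun x y : 𝒳 => ntk (d := d) σ γ x y) =
      fun x y : 𝒳 => ∫ b, neuronKernel (d := d) σ γ b x y ∂(uniformSphere d) := by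
    ext x y
    exact ntk_eq_integral hd hσ x y
  rw [e]
  exact measurable_integral_kernel (ν := uniformSphere d)
    (K := fun b (x y : 𝒳) => neuronKernel (d := d) σ γ b x y) (measurable_neuronKernel hσ)

theorem ae_prod_abs_rfKernel_symInit_le [IsProbabilityMeasure μ] (hσ : ActivationAssumption σ)
    (hγ : γ ∈ Set.Icc (0 : ℝ) 1) (hμ : ∀ᵐ x : 𝒳 ∂μ, ‖(x : EuclideanSpace ℝ (Fin d))‖ ≤ 1)
    {m : ℕ} (b : Fin m → sphere (0 : EuclideanSpace ℝ (Fin d)) 1) :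
    ∀ᵐ p ∂(μ.prod μ), |rfKernel (d := d) σ γ (symInit b) p.1 p.2| ≤ 12 := by
  filter_upwards [Measure.quasiMeasurePreserving_fst.ae hμ,
    Measure.quasiMeasurePreserving_snd.ae hμ] with p h1 h2
  exact RKHS.abs_kernel_le (k := fun x y : 𝒳 => rfKernel σ γ (symInit b) x y)
    (kernel_rfSpace 𝒳 (symInit b)) (by norm_num)
    (rfKernel_symInit_self_le hσ hγ b h1) (rfKernel_symInit_self_le hσ hγ b h2)

theorem inner_conj_eq_kernelForm [IsProbabilityMeasure μ] {k : 𝒳 → 𝒳 → ℝ}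
    {T R : Lp ℝ 2 μ →L[ℝ] Lp ℝ 2 μ} (hT : IsIntegralOperator μ k T) (hR : IsSelfAdjoint R)
    (hk : Measurable (Function.uncurry k)) {C : ℝ} (hb : ∀ᵐ p ∂(μ.prod μ), |k p.1 p.2| ≤ C)
    (x : Lp ℝ 2 μ) : ⟪x, (R * T * R) x⟫_ℝ = kernelForm μ k (R x) := by
  rw [← hT.inner_apply_self hk hb (R x)]
  have h := (ContinuousLinearMap.isSelfAdjoint_iff_isSymmetric.1 hR) x (T (R x))
  exact h.symm

theorem exists_neuron_operator [IsProbabilityMeasure μ] (hσ : ActivationAssumption σ)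
    (hγ : γ ∈ Set.Icc (0 : ℝ) 1) (hμ : ∀ᵐ x : 𝒳 ∂μ, ‖(x : EuclideanSpace ℝ (Fin d))‖ ≤ 1)
    (b : sphere (0 : EuclideanSpace ℝ (Fin d)) 1)
    {R : Lp ℝ 2 μ →L[ℝ] Lp ℝ 2 μ} (hR : IsSelfAdjoint R) :
    ∃ (T : Lp ℝ 2 μ →L[ℝ] Lp ℝ 2 μ) (t : ℝ), T.IsPositive ∧
      IsIntegralOperator μ (fun x y : 𝒳 => neuronKernel (d := d) σ γ b x y) T ∧
      t ≤ ‖R‖ ^ 2 * 12 ∧ HasTrace (R * T * R) t := by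
  have hk : ∀ x y : 𝒳, RKHS.kernel (RFSpace 𝒳 σ γ fun _ : Fin 1 => b) x y 1 =
      neuronKernel (d := d) σ γ b x y := fun x y => by rw [kernel_rfSpace, rfKernel_one]
  have hm : ∀ y : 𝒳, Measurable fun x : 𝒳 => neuronKernel (d := d) σ γ b x y := fun y => by
    have h : Measurable fun x : 𝒳 => (b, x, y) :=
      measurable_const.prodMk (measurable_id.prodMk measurable_const)
    have h2 := (measurable_neuronKernel (γ := γ) hσ).comp h
    exact h2
  have hb : ∀ᵐ x : 𝒳 ∂μ, neuronKernel (d := d) σ γ b x x ≤ 12 :=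
    hμ.mono fun x hx => neuronKernel_self_le hσ hγ b hx
  obtain ⟨V, hV⟩ := RKHS.exists_embedding
    (k := fun x y : 𝒳 => neuronKernel (d := d) σ γ b x y) hk hm hb
  obtain ⟨t, ht, htr⟩ := RKHS.exists_hasTrace_conj hk hm hb hV hR
  exact ⟨_, t, ContinuousLinearMap.isPositive_self_comp_adjoint V,
    RKHS.isIntegralOperator hk hV, ht, htr⟩

/-- The trace `tr (R T_b R)`, with `T_b` the integral operator of a single neuron, is a bounded
random variable whose mean is `tr (R Σ R)` for the infinite-width operator `Σ`. -/
theorem exists_trace_neuron (hd : 0 < d) [IsProbabilityMeasure μ] (hσ : ActivationAssumption σ)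
    (hγ : γ ∈ Set.Icc (0 : ℝ) 1) (hμ : ∀ᵐ x : 𝒳 ∂μ, ‖(x : EuclideanSpace ℝ (Fin d))‖ ≤ 1)
    {S R : Lp ℝ 2 μ →L[ℝ] Lp ℝ 2 μ}
    (hS : IsIntegralOperator μ (fun x y : 𝒳 => ntk (d := d) σ γ x y) S)
    (hR : IsSelfAdjoint R) {s : ℝ} (hs : HasTrace (R * S * R) s) :
    ∃ ψ : sphere (0 : EuclideanSpace ℝ (Fin d)) 1 → ℝ, Measurable ψ ∧
      (∀ b, |ψ b| ≤ ‖R‖ ^ 2 * 12) ∧ ∫ b, ψ b ∂(uniformSphere d) = s ∧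
      ∀ (m : ℕ) (b : Fin m → sphere (0 : EuclideanSpace ℝ (Fin d)) 1)
        (T : Lp ℝ 2 μ →L[ℝ] Lp ℝ 2 μ) (t : ℝ),
        IsIntegralOperator μ (fun x y : 𝒳 => rfKernel (d := d) σ γ (symInit b) x y) T →
        HasTrace (R * T * R) t → t = (m : ℝ)⁻¹ * ∑ r, ψ (b r) := by
  have := isProbabilityMeasure_uniformSphere hd
  set K : sphere (0 : EuclideanSpace ℝ (Fin d)) 1 → 𝒳 → 𝒳 → ℝ :=
    fun b x y => neuronKernel σ γ b x y with hKdef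
  have hK : Measurable fun p : sphere (0 : EuclideanSpace ℝ (Fin d)) 1 × 𝒳 × 𝒳 =>
    K p.1 p.2.1 p.2.2 := measurable_neuronKernel hσ
  have hKb : ∀ b, Measurable (Function.uncurry (K b)) := fun b => by
    have h : Measurable fun p : 𝒳 × 𝒳 => (b, p) := measurable_const.prodMk measurable_id
    have h2 := hK.comp h
    exact h2
  have hC : ∀ᵐ p ∂(μ.prod μ), ∀ b, |K b p.1 p.2| ≤ 12 := ae_prod_abs_neuronKernel_le hσ hγ hμ
  choose T ψ hTpos hTint hψle hψtr using fun b => exists_neuron_operator hσ hγ hμ b hR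
  obtain ⟨w, e, -⟩ := exists_hilbertBasis ℝ (Lp ℝ 2 μ)
  have : Fact ((2 : ℝ≥0∞) ≠ ∞) := ⟨ENNReal.ofNat_ne_top⟩
  have hwc : Countable w := e.orthonormal.countable
  have hform : ∀ b i, ⟪e i, (R * T b * R) (e i)⟫_ℝ = kernelForm μ (K b) (R (e i)) := fun b i =>
    inner_conj_eq_kernelForm (hTint b) hR (hKb b) (hC.mono fun p hp => hp b) (e i)
  have hpos : ∀ b i, 0 ≤ kernelForm μ (K b) (R (e i)) := fun b i => by
    rw [← (hTint b).inner_apply_self (hKb b) (hC.mono fun p hp => hp b)]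
    exact (hTpos b).inner_nonneg_right _
  have hsum : ∀ b, HasSum (fun i => kernelForm μ (K b) (R (e i))) (ψ b) := fun b => by
    simpa only [hform] using hψtr b w e
  have hSform : HasSum (fun i => kernelForm μ
      (fun x y => ∫ b, K b x y ∂(uniformSphere d)) (R (e i))) s := by
    have h := hs w e
    have hkb : ∀ᵐ p ∂(μ.prod μ), |ntk (d := d) σ γ p.1 p.2| ≤ 12 :=
      ae_prod_abs_ntk_le hd hσ hγ hμ
    simp only [inner_conj_eq_kernelForm hS hR (measurable_ntk hd hσ) hkb] at h
    simpa only [ntk_eq_integral hd hσ] using h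
  obtain ⟨hψm, hψi⟩ := integral_trace_eq hK hC hpos hsum hSform
  refine ⟨ψ, hψm, fun b => ?_, hψi, fun m b T' t hT' ht => ?_⟩
  · rw [abs_of_nonneg ((hsum b).nonneg (hpos b))]
    exact hψle b
  · have h1 := ht w e
    simp only [inner_conj_eq_kernelForm hT' hR (measurable_rfKernel hσ _)
      (ae_prod_abs_rfKernel_symInit_le hσ hγ hμ b)] at h1
    have h2 : HasSum (fun i => (m : ℝ)⁻¹ * ∑ r, kernelForm μ (K (b r)) (R (e i)))
        ((m : ℝ)⁻¹ * ∑ r, ψ (b r)) :=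
      (hasSum_sum fun r _ => hsum (b r)).mul_left _
    refine h1.unique (h2.congr_fun fun i => ?_)
    rw [← kernelForm_average hKb hC]
    simp only [rfKernel_symInit, hKdef]

/-- If the kernels are `lam`-close in `L²(μ ⊗ μ)`, then `Σ_∞ ≤ Σ_M + lam`. -/
theorem norm_adjoint_sq_le_of_integral_le (hd : 0 < d) [IsProbabilityMeasure μ]
    (hσ : ActivationAssumption σ) (hγ : γ ∈ Set.Icc (0 : ℝ) 1)
    (hμ : ∀ᵐ x : 𝒳 ∂μ, ‖(x : EuclideanSpace ℝ (Fin d))‖ ≤ 1)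
    {H : Type*} [NormedAddCommGroup H] [InnerProductSpace ℝ H] [CompleteSpace H]
    {V : H →L[ℝ] Lp ℝ 2 μ}
    (hV : IsIntegralOperator μ (fun x y : 𝒳 => ntk (d := d) σ γ x y) (V ∘L V.adjoint))
    {m : ℕ} {b : Fin m → sphere (0 : EuclideanSpace ℝ (Fin d)) 1} {T : Lp ℝ 2 μ →L[ℝ] Lp ℝ 2 μ}
    (hT : IsIntegralOperator μ (fun x y : 𝒳 => rfKernel (d := d) σ γ (symInit b) x y) T)
    {lam : ℝ} (hlam : 0 < lam)
    (hle : ∫ p : 𝒳 × 𝒳, (rfKernel (d := d) σ γ (symInit b) p.1 p.2 - ntk (d := d) σ γ p.1 p.2) ^ 2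
      ∂(μ.prod μ) ≤ lam ^ 2) (u : Lp ℝ 2 μ) :
    ‖V.adjoint u‖ ^ 2 ≤ ⟪u, T u⟫_ℝ + lam * ‖u‖ ^ 2 := by
  have := isProbabilityMeasure_uniformSphere hd
  have hk₁ : Measurable (Function.uncurry fun x y : 𝒳 => rfKernel σ γ (symInit b) x y) :=
    measurable_rfKernel hσ _
  have hk₂ : Measurable (Function.uncurry fun x y : 𝒳 => ntk (d := d) σ γ x y) :=
    measurable_ntk hd hσ
  have hb₁ := ae_prod_abs_rfKernel_symInit_le hσ hγ hμ b
  have hb₂ : ∀ᵐ p ∂(μ.prod μ), |ntk (d := d) σ γ p.1 p.2| ≤ 12 :=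
    ae_prod_abs_ntk_le hd hσ hγ hμ
  have e1 : ‖V.adjoint u‖ ^ 2 = kernelForm μ (fun x y : 𝒳 => ntk (d := d) σ γ x y) u := by
    rw [← hV.inner_apply_self hk₂ hb₂, ContinuousLinearMap.comp_apply,
      ← ContinuousLinearMap.adjoint_inner_left, real_inner_self_eq_norm_sq]
  rw [e1, hT.inner_apply_self hk₁ hb₁]
  set D : 𝒳 → 𝒳 → ℝ := fun x y => rfKernel (d := d) σ γ (symInit b) x y - ntk (d := d) σ γ x y
    with hD
  have e2 : kernelForm μ D u =
      kernelForm μ (fun x y : 𝒳 => rfKernel (d := d) σ γ (symInit b) x y) u -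
        kernelForm μ (fun x y : 𝒳 => ntk (d := d) σ γ x y) u := by
    simp only [kernelForm, hD, mul_sub]
    exact integral_sub (integrable_mul_mul_kernel hk₁ hb₁ u) (integrable_mul_mul_kernel hk₂ hb₂ u)
  have hDb : ∀ᵐ p ∂(μ.prod μ), |D p.1 p.2| ≤ 24 := by
    filter_upwards [hb₁, hb₂] with p h1 h2
    exact (abs_sub _ _).trans (by linarith)
  have h := abs_kernelForm_le (hk₁.sub hk₂ : Measurable (Function.uncurry D)) hDb u
  have h2 : √(∫ p, D p.1 p.2 ^ 2 ∂(μ.prod μ)) ≤ lam :=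
    Real.sqrt_le_iff.2 ⟨hlam.le, hle⟩
  have h3 := (neg_le_abs _).trans (h.trans (mul_le_mul_of_nonneg_right h2 (sq_nonneg ‖u‖)))
  rw [e2] at h3
  linarith

end Comparison

/-! ### The high-probability statement -/

theorem exists_forall_ge_ofReal_div_le (a : ℝ) {ε δ : ℝ} (hε : 0 < ε) (hδ : 0 < δ) :
    ∃ N : ℕ, 0 < N ∧ ∀ m : ℕ, N ≤ m →
      ENNReal.ofReal (a / m) / ENNReal.ofReal ε ≤ ENNReal.ofReal δ := by
  obtain ⟨n, hn⟩ := exists_nat_ge (a / (ε * δ))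
  refine ⟨n + 1, n.succ_pos, fun m hm => ?_⟩
  have hm0 : (0 : ℝ) < m := by exact_mod_cast n.succ_pos.trans_le hm
  rw [← ENNReal.ofReal_div_of_pos hε]
  refine ENNReal.ofReal_le_ofReal ?_
  rw [div_div, div_le_iff₀ (by positivity)]
  have h1 : (n : ℝ) ≤ m := by exact_mod_cast (Nat.le_succ n).trans hm
  have h2 := (div_le_iff₀ (by positivity)).1 (hn.trans h1)
  linarith

set_option maxHeartbeats 1000000 in
theorem propositionB {d : ℕ} (hd : 0 < d)
    (𝒳 : Set (EuclideanSpace ℝ (Fin d))) (h𝒳 : MeasurableSet 𝒳)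
    (𝒴 : Set ℝ) (h𝒴 : MeasurableSet 𝒴)
    (ρ : Measure (𝒳 × 𝒴)) [IsProbabilityMeasure ρ]
    (σ : ℝ → ℝ) (hσ : ActivationAssumption σ)
    (hsupp : (ρ.fst.map Subtype.val).support ⊆ closedBall (0 : EuclideanSpace ℝ (Fin d)) 1)
    (hlabel : 𝒴 ⊆ Set.Icc (-1) 1)
    (γ : ℝ) (hγ : γ ∈ Set.Icc (0 : ℝ) 1)
    {Hinf : Type*} [NormedAddCommGroup Hinf] [InnerProductSpace ℝ Hinf] [CompleteSpace Hinf]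
    [RKHS ℝ Hinf 𝒳 ℝ] (hHinf : RKHS.kernel Hinf = kernelMatrix 𝒳 (ntk σ γ))
    (gρ : Hinf) (hgρ : IsBayesRule ρ (gρ : 𝒳 → ℝ))
    (lam : ℝ) (hlam : 0 < lam) :
    ∃ Sinf : Lp ℝ 2 ρ.fst →L[ℝ] Lp ℝ 2 ρ.fst,
      IsIntegralOperator ρ.fst (fun x y : 𝒳 => ntk (d := d) σ γ x y) Sinf ∧
      IsUnit (Sinf + lam • (1 : Lp ℝ 2 ρ.fst →L[ℝ] Lp ℝ 2 ρ.fst)) ∧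
      ∀ δ : ℝ, δ ∈ Set.Ioo (0 : ℝ) 1 → ∃ M₀ : ℕ, 0 < M₀ ∧ ∀ m : ℕ, M₀ ≤ m + m →
        (Measure.pi fun _ : Fin m => uniformSphere d)
          {b | ¬ ∃ (SM A : Lp ℝ 2 ρ.fst →L[ℝ] Lp ℝ 2 ρ.fst)
              (g : RFSpace 𝒳 σ γ (symInit b)) (G : Lp ℝ 2 ρ.fst),
              IsIntegralOperator ρ.fst (fun x y : 𝒳 => rfKernel (d := d) σ γ (symInit b) x y) SM ∧
              IsInvSqrt (SM + lam • (1 : Lp ℝ 2 ρ.fst →L[ℝ] Lp ℝ 2 ρ.fst)) A ∧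
              IsRegularizedMinimizer ρ lam g ∧
              (∀ h : RFSpace 𝒳 σ γ (symInit b), IsRegularizedMinimizer ρ lam h → h = g) ∧
              (G : 𝒳 → ℝ) =ᵐ[ρ.fst] (g : 𝒳 → ℝ) ∧
              ‖Ring.inverse (SM + lam • (1 : Lp ℝ 2 ρ.fst →L[ℝ] Lp ℝ 2 ρ.fst)) G‖ ^ 2 ≤
                2 * lam⁻¹ * ‖gρ‖ ^ 2 ∧
              ‖A G‖ ^ 2 ≤ 2 * ‖gρ‖ ^ 2 ∧
              (lam ≤ ‖Sinf‖ → ∃ tM tinf : ℝ,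
                HasTrace (SM * Ring.inverse
                  (SM + lam • (1 : Lp ℝ 2 ρ.fst →L[ℝ] Lp ℝ 2 ρ.fst))) tM ∧
                HasTrace (Sinf * Ring.inverse
                  (Sinf + lam • (1 : Lp ℝ 2 ρ.fst →L[ℝ] Lp ℝ 2 ρ.fst))) tinf ∧
                tM ≤ 3 * tinf)} ≤ ENNReal.ofReal δ := by
  set μ : Measure 𝒳 := ρ.fst with hμdef
  have := isProbabilityMeasure_uniformSphere hd
  have hμ : ∀ᵐ x : 𝒳 ∂μ, ‖(x : EuclideanSpace ℝ (Fin d))‖ ≤ 1 := ae_norm_le_one_of_support hsupp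
  have hkinf : ∀ x y : 𝒳, RKHS.kernel Hinf x y 1 = ntk (d := d) σ γ x y := fun x y => by
    rw [hHinf]
    simp [kernelMatrix]
  have hminf : ∀ y : 𝒳, Measurable fun x : 𝒳 => ntk (d := d) σ γ x y := fun y => by
    have h : Measurable fun x : 𝒳 => (x, y) := measurable_id.prodMk measurable_const
    have h2 := (measurable_ntk (𝒳 := 𝒳) (γ := γ) hd hσ).comp h
    exact h2
  have hbinf : ∀ᵐ x : 𝒳 ∂μ, ntk (d := d) σ γ x x ≤ 12 :=
    hμ.mono fun x hx => ntk_self_le hd hσ hγ hx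
  obtain ⟨V, hV⟩ := RKHS.exists_embedding (H := Hinf)
    (k := fun x y : 𝒳 => ntk (d := d) σ γ x y) hkinf hminf hbinf
  have hSint : IsIntegralOperator μ (fun x y : 𝒳 => ntk (d := d) σ γ x y) (V ∘L V.adjoint) :=
    RKHS.isIntegralOperator hkinf hV
  have hSpos : (V ∘L V.adjoint).IsPositive := ContinuousLinearMap.isPositive_self_comp_adjoint V
  refine ⟨V ∘L V.adjoint, hSint, hSpos.isUnit_add_smul_one hlam, fun δ hδ => ?_⟩
  set R := resolventAt (V ∘L V.adjoint) lam with hR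
  have hRsa : IsSelfAdjoint R := by
    rw [ContinuousLinearMap.isSelfAdjoint_iff_isSymmetric]
    exact fun x y => inner_resolventAt_comm hSpos hlam x y
  obtain ⟨tinf, htinf⟩ := RKHS.exists_hasTrace_resolventAt hkinf hminf hbinf hV hlam
  obtain ⟨s, -, hs⟩ := RKHS.exists_hasTrace_conj hkinf hminf hbinf hV hRsa
  obtain ⟨ψ, hψm, hψb, hψi, hψavg⟩ := exists_trace_neuron hd hσ hγ hμ hSint hRsa hs
  have hδ2 : 0 < δ / 2 := half_pos hδ.1
  obtain ⟨N₁, hN₁, h₁⟩ := exists_forall_ge_ofReal_div_le (12 ^ 2) (pow_pos hlam 2) hδ2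
  obtain ⟨N₂, -, h₂⟩ := exists_forall_ge_ofReal_div_le ((‖R‖ ^ 2 * 12) ^ 2)
    (pow_pos (inv_pos.2 hlam) 2) hδ2
  refine ⟨2 * (N₁ + N₂), by omega, fun m hm => ?_⟩
  have hm₁ : N₁ ≤ m := by omega
  have hm₂ : N₂ ≤ m := by omega
  have hm0 : 0 < m := hN₁.trans_le hm₁
  have hK := measurable_neuronKernel (𝒳 := 𝒳) (γ := γ) hσ
  have hev₁ := (measure_pi_kernel_sub_sq_ge_le (ν := uniformSphere d) (μ := μ)
    (K := fun b (x y : 𝒳) => neuronKernel (d := d) σ γ b x y) hK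
    (ae_prod_abs_neuronKernel_le hσ hγ hμ) hm0 (pow_pos hlam 2)).trans (h₁ m hm₁)
  have hev₂ := (measure_pi_average_ge_le (ν := uniformSphere d) hψm hψb hm0
    (inv_pos.2 hlam)).trans (h₂ m hm₂)
  have hsum : ENNReal.ofReal (δ / 2) + ENNReal.ofReal (δ / 2) = ENNReal.ofReal δ := by
    rw [← ENNReal.ofReal_add hδ2.le hδ2.le, add_halves]
  rw [← hsum]
  refine le_trans (measure_mono fun b hb => ?_)
    ((measure_union_le _ _).trans (add_le_add hev₁ hev₂))
  by_contra hgood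
  rw [Set.mem_union, not_or] at hgood
  obtain ⟨hg₁, hg₂⟩ := hgood
  apply hb
  clear hb
  have hk : ∀ x y : 𝒳, RKHS.kernel (RFSpace 𝒳 σ γ (symInit b)) x y 1 =
      rfKernel (d := d) σ γ (symInit b) x y := kernel_rfSpace 𝒳 (symInit b)
  have hmeas : ∀ y : 𝒳, Measurable fun x : 𝒳 => rfKernel (d := d) σ γ (symInit b) x y :=
    fun y => by
      have h : Measurable fun x : 𝒳 => (x, y) := measurable_id.prodMk measurable_const
      have h2 := (measurable_rfKernel (𝒳 := 𝒳) (γ := γ) hσ (symInit b)).comp h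
      exact h2
  have hbd : ∀ᵐ x : 𝒳 ∂μ, rfKernel (d := d) σ γ (symInit b) x x ≤ 12 :=
    hμ.mono fun x hx => rfKernel_symInit_self_le hσ hγ b hx
  obtain ⟨W, hW⟩ := RKHS.exists_embedding (H := RFSpace 𝒳 σ γ (symInit b))
    (k := fun x y : 𝒳 => rfKernel (d := d) σ γ (symInit b) x y) hk hmeas hbd
  have hTint : IsIntegralOperator μ (fun x y : 𝒳 => rfKernel (d := d) σ γ (symInit b) x y)
      (W ∘L W.adjoint) := RKHS.isIntegralOperator hk hW
  have hTpos : (W ∘L W.adjoint).IsPositive := ContinuousLinearMap.isPositive_self_comp_adjoint W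
  obtain ⟨A, hA⟩ := exists_isInvSqrt hTpos hlam
  -- Outside the first exceptional event `Σ_∞ ≤ Σ_M + lam`, hence `⟪gρ, (Σ_M + lam)⁻¹ gρ⟫ ≤ ‖gρ‖²`.
  have hclose : ∫ p : 𝒳 × 𝒳, (rfKernel (d := d) σ γ (symInit b) p.1 p.2 -
      ntk (d := d) σ γ p.1 p.2) ^ 2 ∂(μ.prod μ) ≤ lam ^ 2 := by
    simp only [rfKernel_symInit, ntk_eq_integral hd hσ]
    exact (not_le.1 hg₁).le
  have hsource := inner_resolventAt_le_norm_sq hTpos hlam V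
    (norm_adjoint_sq_le_of_integral_le hd hσ hγ hμ hSint hTint hlam hclose) gρ
  obtain ⟨hnA, hnR⟩ := hA.norm_sq_ridge_le hTpos hlam (V gρ)
  obtain ⟨hmin, huniq⟩ := isRegularizedMinimizer_ridge W hlam (V gρ)
    (integral_nonneg fun z => by positivity) fun h =>
      hgρ.expectedRisk_eq hlabel (RKHS.memLp_coe hkinf hminf hbinf gρ)
        (RKHS.measurable_coe hk hmeas h) (RKHS.memLp_coe hk hmeas hbd h) (hV gρ) (hW h)
  refine ⟨W ∘L W.adjoint, A, _, W (W.adjoint (resolventAt (W ∘L W.adjoint) lam (V gρ))),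
    hTint, hA, hmin, huniq, hW _, ?_, ?_, fun hle => ?_⟩
  · refine hnR.trans ((mul_le_mul_of_nonneg_left hsource (inv_nonneg.2 hlam.le)).trans ?_)
    have : 0 ≤ lam⁻¹ * ‖gρ‖ ^ 2 := by positivity
    linarith
  · exact hnA.trans (hsource.trans (by linarith [sq_nonneg ‖gρ‖]))
  · obtain ⟨tM, htM⟩ := RKHS.exists_hasTrace_resolventAt hk hmeas hbd hW hlam
    obtain ⟨sM, -, hsM⟩ := RKHS.exists_hasTrace_conj hk hmeas hbd hW hRsa
    refine ⟨tM, tinf, htM, htinf, trace_comp_resolventAt_le hTpos V hlam hle htM htinf hsM hs ?_⟩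
    -- Outside the second exceptional event the trace `sM` is close to its mean `s`.
    rw [hψavg m b _ sM hTint hsM, ← hψi]
    exact (not_le.1 hg₂).le
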